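/- For $n\ge 1$ let $B_n\subset\mathbb{R}^{n\times n}$ be the Birkhoff polytope, the convex hull of all $n\times n$ permutation matrices. The combinatorial type of a polytope is its face lattice (all faces, including the empty face and the polytope itself, ordered by inclusion) up to isomorphism of partially ordered sets. Let $\mathcal{L}$ be the combinatorial type of a non-empty $d$-dimensional face of some Birkhoff polytope, and let its Birkhoff dimension $\operatorname{bdim}(\mathcal{L})$ be the smallest $n\ge 1$ such that $\mathcal{L}$ is the combinatorial type of a face of $B_n$. Write $C^k$ for the $k$-dimensional $0/1$-cube ($C^0$ is a point), $\Delta$ for a triangle, and $\operatorname{pyr}(P)$ for the pyramid over a polytope $P$. Assume that $\operatorname{bdim}(\mathcal{L})\ge 2d-2$. Then: 1. if $\operatorname{bdim}(\mathcal{L})=2d$, then $\mathcal{L}$ is the combinatorial type of the cube $C^d$; 2. if $\operatorname{bdim}(\mathcal{L})=2d-1$, then $d\ge 2$ and $\mathcal{L}$ is the combinatorial type of $C^{d-2}\times\Delta$; 3. if $\operatorname{bdim}(\mathcal{L})=2d-2$, then $\mathcal{L}$ is the combinatorial type of one of the following polytopes: (a) a pyramid over a cube, $\operatorname{pyr}(C^{d-1})$,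 with $d\ge 3$; (b) a product of a cube and a pyramid over a cube, $C^a\times\operatorname{pyr}(C^b)$ with $a\ge 1$, $b\ge 2$ and $a+b+1=d$; (c) a product of two triangles and a cube, $\Delta\times\Delta\times C^{d-4}$, with $d\ge 4$. -/

import Mathlib

/-- The `n`-th Birkhoff polytope: the convex hull of all `n × n` permutation matrices. -/
def birkhoffPolytope (n : ℕ) : Set (Matrix (Fin n) (Fin n) ℝ) :=
  convexHull ℝ (Set.range fun σ : Equiv.Perm (Fin n) => σ.permMatrix ℝ)

/-- The face lattice of a polytope `P`: the faces of `P`, ordered by inclusion. A face is the empty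
set, `P` itself, or the intersection of `P` with a supporting hyperplane, i.e. the empty set or the
set of points of `P` where some linear functional (possibly zero) attains its maximum over `P`;
this is Mathlib's `IsExposed`. -/
abbrev FaceLattice {E : Type*} [AddCommGroup E] [Module ℝ E] [TopologicalSpace E]
    (P : Set E) : Type _ :=
  {F : Set E // IsExposed ℝ P F}

/-- The partially ordered set `L` is the combinatorial type of the polytope `P`, that is, `L` is
isomorphic to the face lattice of `P`. -/
def IsCombType (L : Type*) [PartialOrder L] {E : Type*} [AddCommGroup E] [Module ℝ E]
    [TopologicalSpace E] (P : Set E) : Prop :=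
  Nonempty (L ≃o FaceLattice P)

/-- `L` is the combinatorial type of a (non-empty) `d`-dimensional face of some Birkhoff polytope
`B_n`, `n ≥ 1`. The dimension is that of the affine hull. -/
def IsBirkhoffType (L : Type*) [PartialOrder L] (d : ℕ) : Prop :=
  ∃ n : ℕ, 1 ≤ n ∧ ∃ F : Set (Matrix (Fin n) (Fin n) ℝ),
    IsExposed ℝ (birkhoffPolytope n) F ∧ F.Nonempty ∧
      Module.finrank ℝ (vectorSpan ℝ F) = d ∧ IsCombType L F

/-- The Birkhoff dimension of `L`: the smallest `n ≥ 1` such that `L` is the combinatorial type of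
some face of `B_n`. -/
noncomputable def bdim (L : Type*) [PartialOrder L] : ℕ :=
  sInf {n : ℕ | 1 ≤ n ∧ ∃ F : Set (Matrix (Fin n) (Fin n) ℝ),
    IsExposed ℝ (birkhoffPolytope n) F ∧ IsCombType L F}

/-- The `0/1`-cube of dimension `d`: the convex hull of all `0/1`-vectors in `ℝ^d`
(a single point for `d = 0`). -/
def cube (d : ℕ) : Set (Fin d → ℝ) :=
  convexHull ℝ {x | ∀ i, x i = 0 ∨ x i = 1}

/-- The triangle, realized as the standard simplex in `ℝ^3`. -/
def triangle : Set (Fin 3 → ℝ) :=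
  stdSimplex ℝ (Fin 3)

/-- The pyramid over `P`: the convex hull of `P × {0}` and the apex `(0, 1)`. -/
def pyramid {E : Type*} [AddCommGroup E] [Module ℝ E] (P : Set E) : Set (E × ℝ) :=
  convexHull ℝ (P ×ˢ {0} ∪ {(0, 1)})

-- A non-empty face of `B_n` is cut out by vanishing coordinates, so it is the polytope of
-- fractional perfect matchings of a bipartite graph with `n` vertices on each side
-- (`exists_matchPoly_of_isExposed`). Connected components turn into factors of a product. A
-- connected graph with a strictly positive fractional perfect matching has polytope dimension `d =
-- |E| - |A| - |B| + 1` (`IsElementary.finrank_add_card`).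
--
-- Contracting vertices of degree two does not change the polytope, so each component can be
-- replaced by a multigraph with either one vertex per side (a simplex) or `k ≥ 2` vertices per side
-- and all degrees at least 3 (`IsElementary.exists_reduced`). Conversely, parallel edges can be
-- separated at the cost of one new vertex per side for each surplus edge. A multigraph with `k`
-- vertices per side and `p` adjacent pairs thus yields a simple graph with at most `m = k + |E| -
-- p` vertices per side (`realizable_matchPoly`). If `k ≥ 2`, then `p ≥ 2k` and `|E| ≥ 3k`, so `m ≤
-- d + k - 1 ≤ 2d - 2`. Equality forces one double and one single edge at every vertex, and the
-- polytope is then the pyramid over `C^k` (`IsDoubleSingle.affIso_pyramid`). Among simplices, the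
-- defect `2d - m` is 0 for the point and the segment, 1 for the triangle and at least 3 otherwise.
-- Defects add up in products (`Classified.prod`), and total defect at most 2 leaves exactly the
-- listed polytopes.
--
-- Two points complete the argument. The face lattice determines the dimension
-- (`finrank_vectorSpan_eq_of_orderIso`), so the face realizing the minimal `n` is again
-- `d`-dimensional. Moreover, a connected simple graph needs at least 2 vertices per side for a
-- segment and 3 for a triangle. Hence cubes require `n ≥ 2d`, and cube times triangle requires `n ≥
-- 2d - 1`, which keeps the three cases apart.

open Set

-- Affine isomorphism and its effect on dimension and faces.

/-- `P` and `Q` are affinely isomorphic: there are affine maps of the ambient spaces restricting to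
mutually inverse bijections between `P` and `Q`. -/
def AffIso {E F : Type*} [AddCommGroup E] [Module ℝ E] [AddCommGroup F] [Module ℝ F]
    (P : Set E) (Q : Set F) : Prop :=
  ∃ (f : E →ᵃ[ℝ] F) (g : F →ᵃ[ℝ] E), MapsTo f P Q ∧ MapsTo g Q P ∧
    (∀ x ∈ P, g (f x) = x) ∧ ∀ y ∈ Q, f (g y) = y

namespace AffIso

section Algebra

variable {E F G H : Type*} [AddCommGroup E] [Module ℝ E] [AddCommGroup F] [Module ℝ F]
  [AddCommGroup G] [Module ℝ G] [AddCommGroup H] [Module ℝ H]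
  {P : Set E} {Q : Set F} {R : Set G} {S : Set H}

theorem refl (P : Set E) : AffIso P P :=
  ⟨AffineMap.id ℝ E, AffineMap.id ℝ E, fun _ h => h, fun _ h => h, fun _ _ => rfl, fun _ _ => rfl⟩

theorem symm (h : AffIso P Q) : AffIso Q P := by
  obtain ⟨f, g, hf, hg, hgf, hfg⟩ := h
  exact ⟨g, f, hg, hf, hfg, hgf⟩

theorem trans (h : AffIso P Q) (h' : AffIso Q R) : AffIso P R := by
  obtain ⟨f, g, hf, hg, hgf, hfg⟩ := h
  obtain ⟨f', g', hf', hg', hgf', hfg'⟩ := h'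
  refine ⟨f'.comp f, g.comp g', fun x hx => hf' (hf hx), fun x hx => hg (hg' hx), ?_, ?_⟩
  · intro x hx
    simp [hgf' _ (hf hx), hgf _ hx]
  · intro y hy
    simp [hfg _ (hg' hy), hfg' _ hy]

theorem prod (h : AffIso P Q) (h' : AffIso R S) : AffIso (P ×ˢ R) (Q ×ˢ S) := by
  obtain ⟨f, g, hf, hg, hgf, hfg⟩ := h
  obtain ⟨f', g', hf', hg', hgf', hfg'⟩ := h'
  refine ⟨f.prodMap f', g.prodMap g', fun x hx => ⟨hf hx.1, hf' hx.2⟩,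
    fun x hx => ⟨hg hx.1, hg' hx.2⟩, ?_, ?_⟩
  · rintro ⟨x, y⟩ ⟨hx, hy⟩
    simp [hgf _ hx, hgf' _ hy]
  · rintro ⟨x, y⟩ ⟨hx, hy⟩
    simp [hfg _ hx, hfg' _ hy]

theorem of_linear (f : E → F) (g : F → E) (lf : IsLinearMap ℝ f) (lg : IsLinearMap ℝ g)
    (hf : MapsTo f P Q) (hg : MapsTo g Q P) (hgf : ∀ x ∈ P, g (f x) = x)
    (hfg : ∀ y ∈ Q, f (g y) = y) : AffIso P Q :=
  ⟨(IsLinearMap.mk' f lf).toAffineMap, (IsLinearMap.mk' g lg).toAffineMap, hf, hg, hgf, hfg⟩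

theorem prod_comm (P : Set E) (Q : Set F) : AffIso (P ×ˢ Q) (Q ×ˢ P) :=
  of_linear Prod.swap Prod.swap ⟨fun _ _ => rfl, fun _ _ => rfl⟩ ⟨fun _ _ => rfl, fun _ _ => rfl⟩
    (fun _ h => ⟨h.2, h.1⟩) (fun _ h => ⟨h.2, h.1⟩) (fun _ _ => rfl) (fun _ _ => rfl)

theorem prod_assoc (P : Set E) (Q : Set F) (R : Set G) :
    AffIso ((P ×ˢ Q) ×ˢ R) (P ×ˢ (Q ×ˢ R)) :=
  of_linear (fun x => (x.1.1, x.1.2, x.2)) (fun x => ((x.1, x.2.1), x.2.2))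
    ⟨fun _ _ => rfl, fun _ _ => rfl⟩ ⟨fun _ _ => rfl, fun _ _ => rfl⟩
    (fun _ h => ⟨h.1.1, h.1.2, h.2⟩) (fun _ h => ⟨⟨h.1, h.2.1⟩, h.2.2⟩)
    (fun _ _ => rfl) (fun _ _ => rfl)

theorem nonempty (h : AffIso P Q) (hP : P.Nonempty) : Q.Nonempty := by
  obtain ⟨f, g, hf, -⟩ := h
  exact hP.image f |>.mono hf.image_subset

theorem finrank_vectorSpan_le [FiniteDimensional ℝ E] [FiniteDimensional ℝ F] (h : AffIso P Q) :
    Module.finrank ℝ (vectorSpan ℝ Q) ≤ Module.finrank ℝ (vectorSpan ℝ P) := by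
  obtain ⟨f, g, hf, hg, hgf, hfg⟩ := h
  have : Q = f '' P := by
    ext y
    exact ⟨fun hy => ⟨g y, hg hy, hfg y hy⟩, fun ⟨x, hx, e⟩ => e ▸ hf hx⟩
  rw [this, ← AffineMap.map_vectorSpan]
  exact Submodule.finrank_map_le _ _

theorem finrank_vectorSpan_eq [FiniteDimensional ℝ E] [FiniteDimensional ℝ F] (h : AffIso P Q) :
    Module.finrank ℝ (vectorSpan ℝ P) = Module.finrank ℝ (vectorSpan ℝ Q) :=
  le_antisymm h.symm.finrank_vectorSpan_le h.finrank_vectorSpan_le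

end Algebra

section Faces

variable {E F : Type*} [AddCommGroup E] [Module ℝ E] [TopologicalSpace E]
  [AddCommGroup F] [Module ℝ F] [TopologicalSpace F] [IsTopologicalAddGroup F]
  [ContinuousSMul ℝ F] [T2Space F] [FiniteDimensional ℝ F] {P : Set E} {Q : Set F}

theorem isExposed_image {f : E →ᵃ[ℝ] F} {g : F →ᵃ[ℝ] E} (hf : MapsTo f P Q) (hg : MapsTo g Q P)
    (hgf : ∀ x ∈ P, g (f x) = x) (hfg : ∀ y ∈ Q, f (g y) = y) {X : Set E}
    (hX : IsExposed ℝ P X) : IsExposed ℝ Q (f '' X) := by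
  intro hne
  obtain ⟨l, hl⟩ := hX (by simpa using hne)
  -- The transported functional differs from `l ∘ g` by a constant, so it has the same maximizers.
  have key : ∀ z, (l.toLinearMap ∘ₗ g.linear) z = l (g z) - l (g 0) := by
    intro z
    have := g.linearMap_vsub z 0
    simp only [vsub_eq_sub, sub_zero] at this
    simp [this]
  refine ⟨LinearMap.toContinuousLinearMap (l.toLinearMap ∘ₗ g.linear), ?_⟩
  ext z
  simp only [LinearMap.coe_toContinuousLinearMap', key, mem_ofPred_eq, sub_le_sub_iff_right]
  constructor
  · rintro ⟨x, hx, rfl⟩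
    rw [hl] at hx
    refine ⟨hf hx.1, fun y hy => ?_⟩
    rw [hgf x hx.1]
    exact hx.2 _ (hg hy)
  · rintro ⟨hz, h⟩
    refine ⟨g z, ?_, hfg z hz⟩
    rw [hl]
    refine ⟨hg hz, fun y hy => ?_⟩
    have := h (f y) (hf hy)
    rwa [hgf y hy] at this

theorem exists_isExposed (h : AffIso P Q) {X : Set E} (hX : IsExposed ℝ P X) :
    ∃ Y, IsExposed ℝ Q Y ∧ AffIso X Y := by
  obtain ⟨f, g, hf, hg, hgf, hfg⟩ := h
  refine ⟨f '' X, isExposed_image hf hg hgf hfg hX, f, g, mapsTo_image _ _, ?_, ?_, ?_⟩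
  · rintro _ ⟨x, hx, rfl⟩
    rwa [hgf x (hX.subset hx)]
  · exact fun x hx => hgf x (hX.subset hx)
  · rintro _ ⟨x, hx, rfl⟩
    rw [hgf x (hX.subset hx)]

theorem faceLattice_orderIso [IsTopologicalAddGroup E] [ContinuousSMul ℝ E] [T2Space E]
    [FiniteDimensional ℝ E] (h : AffIso P Q) : Nonempty (FaceLattice P ≃o FaceLattice Q) := by
  obtain ⟨f, g, hf, hg, hgf, hfg⟩ := h
  have e1 : ∀ X, IsExposed ℝ P X → g '' (f '' X) = X := by
    intro X hX
    rw [image_image]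
    exact (image_congr fun x hx => hgf x (hX.subset hx)).trans (image_id' X)
  have e2 : ∀ X, IsExposed ℝ Q X → f '' (g '' X) = X := by
    intro X hX
    rw [image_image]
    exact (image_congr fun x hx => hfg x (hX.subset hx)).trans (image_id' X)
  refine ⟨⟨⟨fun X => ⟨f '' X, isExposed_image hf hg hgf hfg X.2⟩,
    fun Y => ⟨g '' Y, isExposed_image hg hf hfg hgf Y.2⟩, fun X => Subtype.ext (e1 _ X.2),
    fun Y => Subtype.ext (e2 _ Y.2)⟩, ?_⟩⟩
  intro X Y
  constructor
  · intro h
    have : g '' (f '' X.1) ⊆ g '' (f '' Y.1) := image_mono h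
    rwa [e1 _ X.2, e1 _ Y.2] at this
  · exact fun h => image_mono h

theorem isCombType [IsTopologicalAddGroup E] [ContinuousSMul ℝ E] [T2Space E]
    [FiniteDimensional ℝ E] (h : AffIso P Q) {L : Type*} [PartialOrder L] (hL : IsCombType L P) :
    IsCombType L Q := by
  obtain ⟨e⟩ := h.faceLattice_orderIso
  obtain ⟨e'⟩ := hL
  exact ⟨e'.trans e⟩

end Faces

end AffIso

-- Faces of polyhedra given by nonnegativity and linear equations.

section Polyhedron

variable {ι : Type*} [Fintype ι]

/-- The polyhedron of nonnegative vectors in the translate of `K` through `c`. -/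
def nonnegSlice (K : Submodule ℝ (ι → ℝ)) (c : ι → ℝ) : Set (ι → ℝ) :=
  {x | (∀ i, 0 ≤ x i) ∧ x - c ∈ K}

/-- The vectors of `K` vanishing wherever `y` does. -/
def supportedIn (K : Submodule ℝ (ι → ℝ)) (y : ι → ℝ) : Submodule ℝ (ι → ℝ) where
  carrier := {v | v ∈ K ∧ ∀ i, y i = 0 → v i = 0}
  add_mem' := fun h h' => ⟨K.add_mem h.1 h'.1, fun i hi => by simp [h.2 i hi, h'.2 i hi]⟩
  zero_mem' := ⟨K.zero_mem, fun _ _ => rfl⟩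
  smul_mem' := fun c _ h => ⟨K.smul_mem c h.1, fun i hi => by simp [h.2 i hi]⟩

theorem exists_pos_step {y v : ι → ℝ} (hy : ∀ i, 0 ≤ y i) (hv : ∀ i, y i = 0 → 0 ≤ v i) :
    ∃ ε > 0, ∀ i, 0 ≤ y i + ε * v i ∧ (0 < y i → 0 < y i + ε * v i) := by
  have : ∀ᶠ ε : ℝ in nhdsWithin 0 (Ioi 0),
      ∀ i, 0 ≤ y i + ε * v i ∧ (0 < y i → 0 < y i + ε * v i) := by
    rw [Filter.eventually_all]
    intro i
    rcases (hy i).eq_or_lt with h | h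
    · filter_upwards [self_mem_nhdsWithin] with ε hε
      have := mul_nonneg (le_of_lt (mem_Ioi.1 hε)) (hv i h.symm)
      exact ⟨by linarith, fun h' => by linarith⟩
    · have hc : Filter.Tendsto (fun ε : ℝ => y i + ε * v i) (nhds 0) (nhds (y i + 0 * v i)) :=
        Continuous.tendsto (by fun_prop) 0
      rw [zero_mul, add_zero] at hc
      filter_upwards [nhdsWithin_le_nhds (hc.eventually (lt_mem_nhds h))] with ε hε
      exact ⟨hε.le, fun _ => hε⟩
  obtain ⟨ε, h, hε⟩ := (this.and self_mem_nhdsWithin).exists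
  exact ⟨ε, hε, h⟩

variable {K : Submodule ℝ (ι → ℝ)} {c : ι → ℝ}

/-- The sum of the coordinates in `Z` is nonnegative on `P`, and it is zero exactly on this set. -/
theorem isExposed_zeroSet {P : Set (ι → ℝ)} (hP : ∀ x ∈ P, ∀ i, 0 ≤ x i) (Z : Set ι) :
    IsExposed ℝ P {x ∈ P | ∀ i ∈ Z, x i = 0} := by
  classical
  rintro ⟨z, hz, hz0⟩
  refine ⟨-∑ i ∈ Finset.univ.filter (· ∈ Z),
    ContinuousLinearMap.proj (R := ℝ) (φ := fun _ : ι => ℝ) i, ?_⟩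
  have key : ∀ x : ι → ℝ, (-∑ i ∈ Finset.univ.filter (· ∈ Z),
      ContinuousLinearMap.proj (R := ℝ) (φ := fun _ : ι => ℝ) i) x =
        -∑ i ∈ Finset.univ.filter (· ∈ Z), x i := by
    intro x; simp
  ext x
  simp only [key, mem_ofPred_eq, neg_le_neg_iff]
  constructor
  · rintro ⟨hx, h⟩
    refine ⟨hx, fun y hy => ?_⟩
    rw [Finset.sum_eq_zero (fun i hi => h i (Finset.mem_filter.1 hi).2)]
    exact Finset.sum_nonneg fun i _ => hP y hy i
  · rintro ⟨hx, h⟩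
    refine ⟨hx, fun i hi => ?_⟩
    have h1 := h z hz
    rw [Finset.sum_eq_zero (f := z) (fun i hi => hz0 i (Finset.mem_filter.1 hi).2)] at h1
    have h2 := le_antisymm h1 (Finset.sum_nonneg fun i _ => hP x hx i)
    exact (Finset.sum_eq_zero_iff_of_nonneg fun i _ => hP x hx i).1 h2 i (by simp [hi])

/-- A point `y` of `F` with fewest zeros acts as a relative interior point: averaging it with
another point of `F` can only remove zeros. Conversely, if `x` vanishes wherever `y` does, the
segment from `x` to `y` can be prolonged slightly beyond `y`, and extremality of `F` gives `x ∈ F`.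
-/
theorem IsExposed.exists_eq_zeroSet {F : Set (ι → ℝ)} (hF : IsExposed ℝ (nonnegSlice K c) F)
    (hne : F.Nonempty) :
    ∃ y ∈ F, F = {x ∈ nonnegSlice K c | ∀ i, y i = 0 → x i = 0} := by
  classical
  have hcv : Convex ℝ (nonnegSlice K c) := by
    intro x hx y hy a b ha hb hab
    refine ⟨fun i => ?_, ?_⟩
    · simpa using add_nonneg (mul_nonneg ha (hx.1 i)) (mul_nonneg hb (hy.1 i))
    · have : a • x + b • y - c = a • (x - c) + b • (y - c) := by
        rw [smul_sub, smul_sub, sub_add_sub_comm, ← add_smul, hab, one_smul]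
      rw [this]
      exact K.add_mem (K.smul_mem _ hx.2) (K.smul_mem _ hy.2)
  have hFc : Convex ℝ F := hF.convex hcv
  obtain ⟨y, hy, hmin⟩ := exists_minimalFor_of_wellFoundedLT (fun y => y ∈ F)
    (fun y : ι → ℝ => (Finset.univ.filter fun i => y i = 0).card) hne
  refine ⟨y, hy, ?_⟩
  ext x
  constructor
  · intro hx
    refine ⟨hF.subset hx, fun i hi => ?_⟩
    by_contra hxi
    have hm : (1 / 2 : ℝ) • x + (1 / 2 : ℝ) • y ∈ F :=
      hFc hx hy (by norm_num) (by norm_num) (by norm_num)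
    have hx0 := (hF.subset hx).1
    have hy0 := (hF.subset hy).1
    have hlt : (Finset.univ.filter fun i => ((1 / 2 : ℝ) • x + (1 / 2 : ℝ) • y) i = 0).card <
        (Finset.univ.filter fun i => y i = 0).card := by
      apply Finset.card_lt_card
      rw [Finset.ssubset_iff_of_subset]
      · refine ⟨i, by simp [hi], ?_⟩
        simp [hi, hxi]
      · intro j
        simp only [Finset.mem_filter, Finset.mem_univ, true_and, Pi.add_apply, Pi.smul_apply,
          smul_eq_mul]
        intro h
        linarith [hx0 j, hy0 j]
    exact absurd (hmin hm hlt.le) (not_le.2 hlt)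
  · rintro ⟨hx, h⟩
    have hyP := hF.subset hy
    obtain ⟨ε, hε, hstep⟩ := exists_pos_step (y := y) (v := y - x) hyP.1
      (fun i hi => by simp [hi, h i hi])
    have hz : y + ε • (y - x) ∈ nonnegSlice K c := by
      refine ⟨fun i => by simpa using (hstep i).1, ?_⟩
      have : y + ε • (y - x) - c = (y - c) + ε • ((y - c) - (x - c)) := by
        rw [sub_sub_sub_cancel_right]; abel
      rw [this]
      exact K.add_mem hyP.2 (K.smul_mem _ (K.sub_mem hyP.2 hx.2))
    refine hF.isExtreme.2 hx hz hy ?_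
    have h1 : (1 + ε) ≠ 0 := by positivity
    refine ⟨ε / (1 + ε), 1 / (1 + ε), by positivity, by positivity, by field_simp; ring, ?_⟩
    ext i
    simp only [Pi.add_apply, Pi.smul_apply, smul_eq_mul, Pi.sub_apply]
    field_simp
    ring

theorem vectorSpan_zeroSet {y : ι → ℝ} (hy : y ∈ nonnegSlice K c) :
    vectorSpan ℝ {x ∈ nonnegSlice K c | ∀ i, y i = 0 → x i = 0} = supportedIn K y := by
  apply le_antisymm
  · rw [vectorSpan_def, Submodule.span_le]
    rintro _ ⟨a, ⟨ha, ha0⟩, b, ⟨hb, hb0⟩, rfl⟩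
    refine ⟨?_, fun i hi => by simp [ha0 i hi, hb0 i hi]⟩
    simpa using K.sub_mem ha.2 hb.2
  · rintro v ⟨hv, hv0⟩
    obtain ⟨ε, hε, hstep⟩ := exists_pos_step (y := y) (v := v) hy.1 (fun i hi => (hv0 i hi).ge)
    have hz : y + ε • v ∈ {x ∈ nonnegSlice K c | ∀ i, y i = 0 → x i = 0} := by
      refine ⟨⟨fun i => by simpa using (hstep i).1, ?_⟩, fun i hi => by simp [hi, hv0 i hi]⟩
      rw [add_sub_right_comm]
      exact K.add_mem hy.2 (K.smul_mem _ hv)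
    have := vsub_mem_vectorSpan ℝ hz (⟨hy, fun i hi => hi⟩ :
      y ∈ {x ∈ nonnegSlice K c | ∀ i, y i = 0 → x i = 0})
    rw [vsub_eq_sub, add_sub_cancel_left] at this
    have h2 := Submodule.smul_mem _ ε⁻¹ this
    rwa [smul_smul, inv_mul_cancel₀ hε.ne', one_smul] at h2

/-- Existence of a vertex: a point of minimal support admits no nonzero direction inside its
support. -/
theorem exists_supportedIn_eq_bot (hne : (nonnegSlice K c).Nonempty) :
    ∃ y ∈ nonnegSlice K c, supportedIn K y = ⊥ := by
  classical
  obtain ⟨y, hy, hmin⟩ := exists_minimalFor_of_wellFoundedLT (fun y => y ∈ nonnegSlice K c)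
    (fun y : ι → ℝ => (Finset.univ.filter fun i => y i ≠ 0).card) hne
  refine ⟨y, hy, ?_⟩
  have main : ∀ v ∈ supportedIn K y, ∀ i, 0 ≤ v i := by
    intro v hv i
    by_contra hi
    push Not at hi
    obtain ⟨j, hj, hjmin⟩ := Finset.exists_min_image (Finset.univ.filter fun j => v j < 0)
      (fun j => y j / (-v j)) ⟨i, by simpa using hi⟩
    simp only [Finset.mem_filter, Finset.mem_univ, true_and] at hj hjmin
    -- Ratio test: the longest step along `v` that keeps all coordinates nonnegative; it makes
    -- coordinate `j` vanish.
    set t := y j / (-v j) with ht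
    have ht0 : 0 ≤ t := div_nonneg (hy.1 j) (by linarith)
    have hz : y + t • v ∈ nonnegSlice K c := by
      refine ⟨fun k => ?_, ?_⟩
      · simp only [Pi.add_apply, Pi.smul_apply, smul_eq_mul]
        rcases lt_or_ge (v k) 0 with hk | hk
        · have := (le_div_iff₀ (by linarith : 0 < -v k)).1 (hjmin k hk)
          linarith
        · have := mul_nonneg ht0 hk
          linarith [hy.1 k]
      · rw [add_sub_right_comm]
        exact K.add_mem hy.2 (K.smul_mem _ hv.1)
    have hlt : (Finset.univ.filter fun i => (y + t • v) i ≠ 0).card <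
        (Finset.univ.filter fun i => y i ≠ 0).card := by
      apply Finset.card_lt_card
      rw [Finset.ssubset_iff_of_subset]
      · refine ⟨j, ?_, ?_⟩
        · simp only [Finset.mem_filter, Finset.mem_univ, true_and]
          exact fun h => hj.ne (hv.2 j h)
        · simp only [Finset.mem_filter, Finset.mem_univ, true_and, not_not, Pi.add_apply,
            Pi.smul_apply, smul_eq_mul, ht]
          field_simp [hj.ne]
          ring
      · intro k
        simp only [Finset.mem_filter, Finset.mem_univ, true_and]
        intro h h'
        exact h (by simp [h', hv.2 k h'])
    exact absurd (hmin hz hlt.le) (not_le.2 hlt)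
  rw [eq_bot_iff]
  intro v hv
  ext i
  have h1 := main v hv i
  have h2 := main (-v) (Submodule.neg_mem _ hv) i
  simp only [Pi.neg_apply, Pi.zero_apply] at *
  linarith

/-- Among the directions leaving the face of `y` into the polyhedron, take `v` with least support on
the zeros of `y`. Minimality shows that the face reached by a small step along `v` gains at most the
line of `v`. -/
theorem exists_zeroSet_succ {x y : ι → ℝ} (hy : y ∈ nonnegSlice K c) (hx : x ∈ nonnegSlice K c)
    (hxy : ∃ i, y i = 0 ∧ x i ≠ 0) :
    ∃ z ∈ nonnegSlice K c, (∀ i, z i = 0 → y i = 0) ∧ (∃ i, y i = 0 ∧ z i ≠ 0) ∧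
      Module.finrank ℝ (supportedIn K z) ≤ Module.finrank ℝ (supportedIn K y) + 1 := by
  classical
  obtain ⟨v, ⟨hvK, hv0, hvne⟩, hmin⟩ := exists_minimalFor_of_wellFoundedLT
    (fun v : ι → ℝ => v ∈ K ∧ (∀ i, y i = 0 → 0 ≤ v i) ∧ ∃ i, y i = 0 ∧ v i ≠ 0)
    (fun v => (Finset.univ.filter fun i => y i = 0 ∧ v i ≠ 0).card)
    ⟨x - y, by simpa using K.sub_mem hx.2 hy.2, fun i hi => by simpa [hi] using hx.1 i, by
      obtain ⟨i, hi, hi'⟩ := hxy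
      exact ⟨i, hi, by simpa [hi] using hi'⟩⟩
  obtain ⟨ε, hε, hstep⟩ := exists_pos_step hy.1 hv0
  have hz0 : ∀ i, (y + ε • v) i = 0 → y i = 0 := by
    intro i hi
    by_contra h
    have := (hstep i).2 (lt_of_le_of_ne (hy.1 i) (Ne.symm h))
    simp only [Pi.add_apply, Pi.smul_apply, smul_eq_mul] at hi
    linarith
  refine ⟨y + ε • v, ⟨fun i => by simpa using (hstep i).1, ?_⟩, hz0, ?_, ?_⟩
  · rw [add_sub_right_comm]
    exact K.add_mem hy.2 (K.smul_mem _ hvK)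
  · obtain ⟨i, hi, hi'⟩ := hvne
    exact ⟨i, hi, by simp [hi, hi', hε.ne']⟩
  · have hle : supportedIn K (y + ε • v) ≤ supportedIn K y ⊔ Submodule.span ℝ {v} := by
      rintro u ⟨huK, hu0⟩
      obtain ⟨j, hj, hjmin⟩ := Finset.exists_min_image
        (Finset.univ.filter fun i => y i = 0 ∧ v i ≠ 0) (fun j => u j / v j) (by
          obtain ⟨i, hi⟩ := hvne
          exact ⟨i, by simpa using hi⟩)
      simp only [Finset.mem_filter, Finset.mem_univ, true_and] at hj hjmin
      -- The least ratio keeps `u - t • v` nonnegative on the zeros of `y` and cancels coordinate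
      -- `j`; minimality of `v` then forces it to vanish on all of them.
      set t := u j / v j with ht
      have hw0 : ∀ i, y i = 0 → v i = 0 → (u - t • v) i = 0 := by
        intro i h1 h2
        have := hu0 i (by simp [h1, h2])
        simp [this, h2]
      have hwK : u - t • v ∈ K := K.sub_mem huK (K.smul_mem _ hvK)
      have hw : ∀ i, y i = 0 → (u - t • v) i = 0 := by
        by_contra hcon
        push Not at hcon
        have hlt : (Finset.univ.filter fun i => y i = 0 ∧ (u - t • v) i ≠ 0).card <
            (Finset.univ.filter fun i => y i = 0 ∧ v i ≠ 0).card := by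
          apply Finset.card_lt_card
          rw [Finset.ssubset_iff_of_subset]
          · refine ⟨j, by simpa using hj, ?_⟩
            have := hj.2
            simp only [Finset.mem_filter, Finset.mem_univ, true_and, not_and, not_not,
              Pi.sub_apply, Pi.smul_apply, smul_eq_mul, ht]
            intro _
            field_simp
            ring
          · intro k
            simp only [Finset.mem_filter, Finset.mem_univ, true_and]
            exact fun h => ⟨h.1, fun h' => h.2 (hw0 k h.1 h')⟩
        refine absurd (hmin ⟨hwK, fun i hi => ?_, hcon⟩ hlt.le) (not_le.2 hlt)
        by_cases hvi : v i = 0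
        · exact (hw0 i hi hvi).ge
        · have hpos : 0 < v i := lt_of_le_of_ne (hv0 i hi) (Ne.symm hvi)
          have := (le_div_iff₀ hpos).1 (hjmin i ⟨hi, hvi⟩)
          simp only [Pi.sub_apply, Pi.smul_apply, smul_eq_mul]
          linarith
      have : u = (u - t • v) + t • v := by abel
      rw [this]
      exact Submodule.add_mem_sup ⟨hwK, hw⟩
        (Submodule.smul_mem _ _ (Submodule.mem_span_singleton_self v))
    calc Module.finrank ℝ (supportedIn K (y + ε • v))
        ≤ Module.finrank ℝ (supportedIn K y ⊔ Submodule.span ℝ {v} : Submodule ℝ (ι → ℝ)) :=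
          Submodule.finrank_mono hle
      _ ≤ Module.finrank ℝ (supportedIn K y) + Module.finrank ℝ (Submodule.span ℝ {v}) :=
          Submodule.finrank_add_le_finrank_add_finrank _ _
      _ ≤ _ := Nat.add_le_add_left
          (by simpa using finrank_span_le_card (R := ℝ) ({v} : Set (ι → ℝ))) _

end Polyhedron

-- The face lattice determines the dimension.

/-- Climb from `b` to the top by steps on which `ρ` grows by exactly one; `τ` grows by at least one
on each. -/
theorem StrictMono.rank_le {X : Type*} [PartialOrder X] [OrderTop X] {ρ τ : X → ℕ}
    (hρ : StrictMono ρ) (hτ : StrictMono τ) (hsucc : ∀ x, x ≠ ⊤ → ∃ y, x < y ∧ ρ y ≤ ρ x + 1)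
    {b : X} (hb : ρ b = 0) : ρ ⊤ ≤ τ ⊤ := by
  have key : ∀ k x, ρ ⊤ - ρ x = k → ρ ⊤ + τ x ≤ τ ⊤ + ρ x := by
    intro k
    induction k using Nat.strong_induction_on with
    | _ k ih =>
      intro x hx
      by_cases hxt : x = ⊤
      · subst hxt
        omega
      · obtain ⟨y, hxy, hy⟩ := hsucc x hxt
        have h1 := hρ hxy
        have h2 := hτ hxy
        have h3 := hρ.monotone (le_top (a := y))
        have := ih (ρ ⊤ - ρ y) (by omega) y rfl
        omega
  have := key _ b rfl
  omega

section Rank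

variable {ι : Type*} [Fintype ι] {K : Submodule ℝ (ι → ℝ)} {c : ι → ℝ}

instance FaceLattice.instOrderTop {E : Type*} [AddCommGroup E] [Module ℝ E] [TopologicalSpace E]
    (P : Set E) : OrderTop (FaceLattice P) where
  top := ⟨P, fun _ => ⟨0, by simp⟩⟩
  le_top := fun F => F.2.subset

open Classical in
/-- One more than the dimension, and `0` for the empty set. -/
noncomputable def faceRank {E : Type*} [AddCommGroup E] [Module ℝ E] (F : Set E) : ℕ :=
  if F.Nonempty then Module.finrank ℝ (vectorSpan ℝ F) + 1 else 0

theorem faceRank_of_nonempty {E : Type*} [AddCommGroup E] [Module ℝ E] {F : Set E}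
    (h : F.Nonempty) : faceRank F = Module.finrank ℝ (vectorSpan ℝ F) + 1 := if_pos h

theorem faceRank_empty {E : Type*} [AddCommGroup E] [Module ℝ E] :
    faceRank (∅ : Set E) = 0 := if_neg (by simp)

theorem strictMono_faceRank :
    StrictMono fun F : FaceLattice (nonnegSlice K c) => faceRank F.1 := by
  rintro ⟨F, hF⟩ ⟨G, hG⟩ hlt
  have hFG : F ⊂ G := hlt
  obtain ⟨g, hgG, hgF⟩ := exists_of_ssubset hFG
  dsimp only
  rw [faceRank_of_nonempty ⟨g, hgG⟩]
  rcases F.eq_empty_or_nonempty with rfl | hFne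
  · simp [faceRank_empty]
  rw [faceRank_of_nonempty hFne]
  refine Nat.add_lt_add_right (Submodule.finrank_lt_finrank_of_lt ?_) 1
  -- A nonempty face contains every point of the polyhedron lying in its affine span, so a larger
  -- face has a larger span.
  refine lt_of_le_of_ne (vectorSpan_mono ℝ hFG.subset) fun heq => ?_
  obtain ⟨y, hy, hFy⟩ := hF.exists_eq_zeroSet hFne
  have h1 := vsub_mem_vectorSpan ℝ hgG (hFG.subset hy)
  rw [← heq, hFy, vectorSpan_zeroSet (hF.subset hy)] at h1
  apply hgF
  rw [hFy]
  exact ⟨hG.subset hgG, fun i hi => by simpa [hi] using h1.2 i hi⟩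

theorem exists_faceRank_succ (hne : (nonnegSlice K c).Nonempty)
    (F : FaceLattice (nonnegSlice K c)) (hF : F ≠ ⊤) :
    ∃ G, F < G ∧ faceRank G.1 ≤ faceRank F.1 + 1 := by
  obtain ⟨F, hFe⟩ := F
  have hface : ∀ z : ι → ℝ,
      IsExposed ℝ (nonnegSlice K c) {x ∈ nonnegSlice K c | ∀ i, z i = 0 → x i = 0} :=
    fun z => isExposed_zeroSet (fun x hx => hx.1) {i | z i = 0}
  rcases F.eq_empty_or_nonempty with rfl | hFne
  · obtain ⟨y, hy, hbot⟩ := exists_supportedIn_eq_bot hne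
    have hyy : y ∈ {x ∈ nonnegSlice K c | ∀ i, y i = 0 → x i = 0} := ⟨hy, fun _ h => h⟩
    refine ⟨⟨_, hface y⟩, ?_, ?_⟩
    · exact (empty_ssubset.2 ⟨y, hyy⟩ : (∅ : Set (ι → ℝ)) ⊂ _)
    · rw [faceRank_of_nonempty ⟨y, hyy⟩, vectorSpan_zeroSet hy, hbot]
      simp
  · obtain ⟨y, hy, hFy⟩ := hFe.exists_eq_zeroSet hFne
    have hyP := hFe.subset hy
    have hx : ∃ x ∈ nonnegSlice K c, ∃ i, y i = 0 ∧ x i ≠ 0 := by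
      by_contra hcon
      push Not at hcon
      apply hF
      apply Subtype.ext
      change F = nonnegSlice K c
      rw [hFy]
      ext x
      exact ⟨fun h => h.1, fun h => ⟨h, fun i hi => hcon x h i hi⟩⟩
    obtain ⟨x, hxP, hxy⟩ := hx
    obtain ⟨z, hz, hzy, ⟨i, hi, hzi⟩, hrank⟩ := exists_zeroSet_succ hyP hxP hxy
    have hzz : z ∈ {x ∈ nonnegSlice K c | ∀ i, z i = 0 → x i = 0} := ⟨hz, fun _ h => h⟩
    refine ⟨⟨_, hface z⟩, ?_, ?_⟩
    · refine lt_of_le_of_ne ?_ ?_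
      · change F ⊆ _
        rw [hFy]
        exact fun w hw => ⟨hw.1, fun j hj => hw.2 j (hzy j hj)⟩
      · intro heq
        have h1 : F = _ := congrArg Subtype.val heq
        have h2 : z ∈ F := h1 ▸ hzz
        rw [hFy] at h2
        exact hzi (h2.2 i hi)
    · rw [faceRank_of_nonempty ⟨z, hzz⟩, vectorSpan_zeroSet hz, faceRank_of_nonempty hFne]
      have : vectorSpan ℝ F = supportedIn K y := by rw [hFy, vectorSpan_zeroSet hyP]
      rw [this]
      omega

theorem faceRank_le_of_orderIso {κ : Type*} [Fintype κ] {K' : Submodule ℝ (κ → ℝ)} {c' : κ → ℝ}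
    (hne : (nonnegSlice K c).Nonempty)
    (e : FaceLattice (nonnegSlice K c) ≃o FaceLattice (nonnegSlice K' c')) :
    faceRank (nonnegSlice K c) ≤ faceRank (nonnegSlice K' c') := by
  have := StrictMono.rank_le (X := FaceLattice (nonnegSlice K c)) strictMono_faceRank
    (strictMono_faceRank.comp e.strictMono) (exists_faceRank_succ hne)
    (b := ⟨∅, fun h => absurd h (by simp)⟩) faceRank_empty
  rw [Function.comp_apply, OrderIso.map_top] at this
  exact this

theorem finrank_vectorSpan_eq_of_orderIso {κ : Type*} [Fintype κ] {K' : Submodule ℝ (κ → ℝ)}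
    {c' : κ → ℝ} (hne : (nonnegSlice K c).Nonempty) (hne' : (nonnegSlice K' c').Nonempty)
    (e : FaceLattice (nonnegSlice K c) ≃o FaceLattice (nonnegSlice K' c')) :
    Module.finrank ℝ (vectorSpan ℝ (nonnegSlice K c)) =
      Module.finrank ℝ (vectorSpan ℝ (nonnegSlice K' c')) := by
  have h := le_antisymm (faceRank_le_of_orderIso hne e) (faceRank_le_of_orderIso hne' e.symm)
  rw [faceRank_of_nonempty hne, faceRank_of_nonempty hne'] at h
  omega

end Rank

-- Vertex sums of edge weights.

section FiberSum

variable {A E : Type} [Fintype E]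

open Classical in
/-- The sum of `x` over the fibre of `l` above `a`. -/
noncomputable def fiberSum (l : E → A) (a : A) (x : E → ℝ) : ℝ :=
  ∑ e, if l e = a then x e else 0

theorem fiberSum_def [DecidableEq A] (l : E → A) (a : A) (x : E → ℝ) :
    fiberSum l a x = ∑ e, if l e = a then x e else 0 :=
  Finset.sum_congr rfl fun _ _ => by congr

theorem fiberSum_add (l : E → A) (a : A) (x y : E → ℝ) :
    fiberSum l a (x + y) = fiberSum l a x + fiberSum l a y := by
  simp only [fiberSum, ← Finset.sum_add_distrib]
  exact Finset.sum_congr rfl fun e _ => by split_ifs <;> simp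

theorem fiberSum_smul (l : E → A) (a : A) (c : ℝ) (x : E → ℝ) :
    fiberSum l a (c • x) = c * fiberSum l a x := by
  simp only [fiberSum, Finset.mul_sum]
  exact Finset.sum_congr rfl fun e _ => by split_ifs <;> simp

theorem fiberSum_sub (l : E → A) (a : A) (x y : E → ℝ) :
    fiberSum l a (x - y) = fiberSum l a x - fiberSum l a y := by
  rw [sub_eq_add_neg, fiberSum_add, ← neg_one_smul ℝ y, fiberSum_smul]
  ring

theorem sum_fiberSum [Fintype A] (l : E → A) (x : E → ℝ) : ∑ a, fiberSum l a x = ∑ e, x e := by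
  classical
  simp only [fiberSum_def]
  rw [Finset.sum_comm]
  exact Finset.sum_congr rfl fun e _ => by simp

theorem fiberSum_of_injective {E' A' : Type} [Fintype E'] {j : E' → E} (hj : j.Injective)
    {i : A' → A} (hi : i.Injective) {l : E → A} {l' : E' → A'} (h : ∀ e, l (j e) = i (l' e))
    {x : E → ℝ} (a : A') (hx : ∀ e, e ∉ range j → l e = i a → x e = 0) :
    fiberSum l (i a) x = fiberSum l' a (x ∘ j) := by
  classical
  rw [fiberSum_def, fiberSum_def]
  refine (Fintype.sum_of_injective j hj _ _ (fun e he => ?_) fun e => ?_).symm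
  · split_ifs with h1
    · exact hx e he h1
    · rfl
  · simp [h, hi.eq_iff]

end FiberSum

-- Fractional perfect matching polytopes.

section MatchPoly

variable {A B E : Type} [Fintype E]

/-- The polytope of fractional perfect matchings of the bipartite multigraph with edge set `E`
whose edge `e` joins `l e` and `r e`. -/
def matchPoly (l : E → A) (r : E → B) : Set (E → ℝ) :=
  {x | (∀ e, 0 ≤ x e) ∧ (∀ a, fiberSum l a x = 1) ∧ ∀ b, fiberSum r b x = 1}

/-- The edge weights all of whose vertex sums vanish. -/
def balanced (l : E → A) (r : E → B) : Submodule ℝ (E → ℝ) where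
  carrier := {x | (∀ a, fiberSum l a x = 0) ∧ ∀ b, fiberSum r b x = 0}
  add_mem' := fun h h' => ⟨fun a => by rw [fiberSum_add, h.1, h'.1, add_zero],
    fun b => by rw [fiberSum_add, h.2, h'.2, add_zero]⟩
  zero_mem' := ⟨fun a => by simp [fiberSum], fun b => by simp [fiberSum]⟩
  smul_mem' := fun c x h => ⟨fun a => by rw [fiberSum_smul, h.1, mul_zero],
    fun b => by rw [fiberSum_smul, h.2, mul_zero]⟩

theorem matchPoly_eq_nonnegSlice {l : E → A} {r : E → B} {c : E → ℝ} (hc : c ∈ matchPoly l r) :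
    matchPoly l r = nonnegSlice (balanced l r) c := by
  ext x
  refine and_congr_right fun _ => ?_
  change _ ↔ (∀ a, _ = (0 : ℝ)) ∧ ∀ b, _ = (0 : ℝ)
  simp only [fiberSum_sub, hc.2.1, hc.2.2, sub_eq_zero]

theorem matchPoly_comm (l : E → A) (r : E → B) : matchPoly l r = matchPoly r l := by
  ext x
  exact and_congr_right fun _ => and_comm

theorem card_eq_of_matchPoly_nonempty [Fintype A] [Fintype B] {l : E → A} {r : E → B}
    (h : (matchPoly l r).Nonempty) : Fintype.card A = Fintype.card B := by
  obtain ⟨x, hx⟩ := h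
  have h1 := sum_fiberSum l x
  have h2 := sum_fiberSum r x
  simp only [hx.2.1, hx.2.2, Finset.sum_const, Finset.card_univ, nsmul_eq_mul, mul_one] at h1 h2
  exact_mod_cast h1.trans h2.symm

theorem le_one_of_mem_matchPoly {l : E → A} {r : E → B} {x : E → ℝ} (hx : x ∈ matchPoly l r)
    (e : E) : x e ≤ 1 := by
  classical
  rw [← hx.2.1 (l e), fiberSum]
  refine le_trans ?_ (Finset.single_le_sum (f := fun e' => if l e' = l e then x e' else 0)
    (fun e' _ => ?_) (Finset.mem_univ e))
  · simp
  · split_ifs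
    exacts [hx.1 e', le_rfl]

theorem fiberSum_comp {E' : Type} [Fintype E'] {j : E' → E} (hj : j.Injective) (l : E → A)
    {x : E → ℝ} (hx : ∀ e ∈ (range j)ᶜ, x e = 0) (a : A) :
    fiberSum l a x = fiberSum (l ∘ j) a (x ∘ j) :=
  fiberSum_of_injective (A' := A) hj (i := id) Function.injective_id (fun _ => rfl) a
    fun e he _ => hx e he

theorem comp_mem_matchPoly {E' : Type} [Fintype E'] {l : E → A} {r : E → B} {j : E' → E}
    (hj : j.Injective) {x : E → ℝ} (hx : x ∈ matchPoly l r) (hx0 : ∀ e ∈ (range j)ᶜ, x e = 0) :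
    x ∘ j ∈ matchPoly (l ∘ j) (r ∘ j) :=
  ⟨fun e => hx.1 _, fun a => by rw [← fiberSum_comp hj l hx0, hx.2.1],
    fun b => by rw [← fiberSum_comp hj r hx0, hx.2.2]⟩

/-- Forcing weights to vanish amounts to deleting edges; the inverse map extends weights by zero. -/
theorem matchPoly_zeroSet_affIso {E' : Type} [Fintype E'] (l : E → A) (r : E → B) {j : E' → E}
    (hj : j.Injective) :
    AffIso {x ∈ matchPoly l r | ∀ e ∈ (range j)ᶜ, x e = 0} (matchPoly (l ∘ j) (r ∘ j)) := by
  have hext : ∀ y : E' → ℝ, Function.extend j y 0 ∘ j = y := fun y => by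
    ext e; simp [hj.extend_apply]
  have hext0 : ∀ y : E' → ℝ, ∀ e ∈ (range j)ᶜ, Function.extend j y 0 e = 0 := fun y e he =>
    Function.extend_apply' _ _ _ he
  refine AffIso.of_linear (fun x => x ∘ j) (fun y => Function.extend j y 0)
    ⟨fun _ _ => rfl, fun _ _ => rfl⟩ (Function.ExtendByZero.linearMap ℝ j).isLinear ?_ ?_ ?_ ?_
  · rintro x ⟨hx, hx0⟩
    exact comp_mem_matchPoly hj hx hx0
  · intro y hy
    refine ⟨⟨fun e => ?_, fun a => ?_, fun b => ?_⟩, hext0 y⟩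
    · by_cases he : e ∈ range j
      · obtain ⟨e', rfl⟩ := he
        exact (hy.1 e').trans_eq (hj.extend_apply y 0 e').symm
      · exact (hext0 y e he).ge
    · rw [fiberSum_comp hj l (hext0 y), hext, hy.2.1]
    · rw [fiberSum_comp hj r (hext0 y), hext, hy.2.2]
  · rintro x ⟨hx, hx0⟩
    ext e
    by_cases he : e ∈ range j
    · obtain ⟨e', rfl⟩ := he
      simp [hj.extend_apply]
    · exact (hext0 _ e he).trans (hx0 e he).symm
  · intro y _
    exact hext y

end MatchPoly

-- Faces of Birkhoff polytopes as matching polytopes of simple graphs.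

section Birkhoff

theorem birkhoffPolytope_affIso (n : ℕ) :
    AffIso (birkhoffPolytope n) (matchPoly (Prod.fst : Fin n × Fin n → Fin n) Prod.snd) := by
  have h1 : ∀ (x : Fin n × Fin n → ℝ) (a), fiberSum Prod.fst a x = ∑ b, x (a, b) := by
    intro x a
    rw [fiberSum_def, Fintype.sum_prod_type, Finset.sum_eq_single a] <;> simp +contextual
  have h2 : ∀ (x : Fin n × Fin n → ℝ) (b), fiberSum Prod.snd b x = ∑ a, x (a, b) := by
    intro x a
    simp [fiberSum_def, Fintype.sum_prod_type]
  -- This is the Birkhoff–von Neumann theorem.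
  have hB : birkhoffPolytope n = {M | M ∈ doublyStochastic ℝ (Fin n)} := by
    rw [birkhoffPolytope, range,
      ← doublyStochastic_eq_convexHull_permMatrix]
    rfl
  rw [hB]
  refine AffIso.of_linear (fun M p => M p.1 p.2) (fun x => Matrix.of fun a b => x (a, b))
    ⟨fun _ _ => rfl, fun _ _ => rfl⟩ ⟨fun _ _ => rfl, fun _ _ => rfl⟩ ?_ ?_
    (fun _ _ => rfl) (fun _ _ => rfl)
  · intro M hM
    obtain ⟨h, hr, hc⟩ := mem_doublyStochastic_iff_sum.1 hM
    exact ⟨fun p => h _ _, fun a => by rw [h1, hr], fun a => by rw [h2, hc]⟩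
  · rintro x ⟨h, hr, hc⟩
    exact mem_doublyStochastic_iff_sum.2 ⟨fun a b => h _, fun a => (h1 x a).symm.trans (hr a),
      fun b => (h2 x b).symm.trans (hc b)⟩

/-- `P` is affinely isomorphic to the matching polytope of a simple bipartite graph with at most
`m` vertices on each side. -/
def Realizable {V : Type*} [AddCommGroup V] [Module ℝ V] (m : ℕ) (P : Set V) : Prop :=
  ∃ (A B E : Type) (_ : Fintype A) (_ : Fintype B) (_ : Fintype E) (l : E → A) (r : E → B),
    Fintype.card A ≤ m ∧ Fintype.card B = Fintype.card A ∧ (Function.Injective fun e => (l e, r e)) ∧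
      AffIso P (matchPoly l r)

theorem matchPoly_equiv_comp {A B A' B' E : Type} [Fintype E] (l : E → A) (r : E → B)
    (α : A ≃ A') (β : B ≃ B') : matchPoly (α ∘ l) (β ∘ r) = matchPoly l r := by
  have h : ∀ {C C' : Type} (m : E → C) (γ : C ≃ C') x c,
      fiberSum (γ ∘ m) (γ c) x = fiberSum m c x := fun m γ x c =>
    fiberSum_of_injective (E' := E) (j := id) (l := γ ∘ m) (l' := m) Function.injective_id
      γ.injective (fun _ => rfl) c fun e he => by simp at he
  ext x
  refine and_congr_right fun _ => and_congr ?_ ?_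
  · rw [← α.forall_congr_right]
    simp only [h]
  · rw [← β.forall_congr_right]
    simp only [h]

/-- A simple graph is a subgraph of a complete bipartite graph, and deleting edges from the latter
passes to a face. -/
theorem Realizable.exists_isExposed {V : Type*} [AddCommGroup V] [Module ℝ V] {m : ℕ} {P : Set V}
    (h : Realizable m P) : ∃ k ≤ m, ∃ F, IsExposed ℝ (birkhoffPolytope k) F ∧ AffIso P F := by
  obtain ⟨A, B, E, _, _, _, l, r, hA, hB, hinj, hP⟩ := h
  refine ⟨_, hA, ?_⟩
  set m := Fintype.card A
  set α := Fintype.equivFin A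
  set β := Fintype.equivFinOfCardEq hB
  have hj : Function.Injective fun e => (α (l e), β (r e)) := by
    intro e e' he
    apply hinj
    simpa using he
  have h1 := matchPoly_zeroSet_affIso (Prod.fst : Fin m × Fin m → Fin m) Prod.snd hj
  have h2 : matchPoly (Prod.fst ∘ fun e => (α (l e), β (r e)))
      (Prod.snd ∘ fun e => (α (l e), β (r e))) = matchPoly l r :=
    matchPoly_equiv_comp l r α β
  rw [h2] at h1
  obtain ⟨F, hF, hF'⟩ := (birkhoffPolytope_affIso m).symm.exists_isExposed
    (isExposed_zeroSet (P := matchPoly (Prod.fst : Fin m × Fin m → Fin m) Prod.snd)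
      (fun x hx => hx.1) (range fun e => (α (l e), β (r e)))ᶜ)
  exact ⟨F, hF, hP.trans (h1.symm.trans hF')⟩

/-- The graph is the support of a relative interior point, which supplies the strictly positive
matching. -/
theorem exists_matchPoly_of_isExposed {n : ℕ} {F : Set (Matrix (Fin n) (Fin n) ℝ)}
    (hF : IsExposed ℝ (birkhoffPolytope n) F) (hne : F.Nonempty) :
    ∃ (E : Type) (_ : Fintype E) (l r : E → Fin n), (Function.Injective fun e => (l e, r e)) ∧
      AffIso F (matchPoly l r) ∧ ∃ x ∈ matchPoly l r, ∀ e, 0 < x e := by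
  classical
  obtain ⟨G, hG, hFG⟩ := (birkhoffPolytope_affIso n).exists_isExposed hF
  obtain ⟨c, hc⟩ := hFG.nonempty hne
  have hcP := hG.subset hc
  rw [matchPoly_eq_nonnegSlice hcP] at hG
  obtain ⟨y, hy, hGy⟩ := hG.exists_eq_zeroSet ⟨c, hc⟩
  have hyP := hG.subset hy
  rw [← matchPoly_eq_nonnegSlice hcP] at hGy hyP
  have hj : Function.Injective (Subtype.val : {p : Fin n × Fin n // y p ≠ 0} → _) :=
    Subtype.val_injective
  have h1 := matchPoly_zeroSet_affIso (Prod.fst : Fin n × Fin n → Fin n) Prod.snd hj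
  have h2 : G = {x ∈ matchPoly (Prod.fst : Fin n × Fin n → Fin n) Prod.snd |
      ∀ e ∈ (range (Subtype.val : {p : Fin n × Fin n // y p ≠ 0} → _))ᶜ, x e = 0} := by
    rw [hGy]
    simp
  rw [← h2] at h1
  refine ⟨{p : Fin n × Fin n // y p ≠ 0}, inferInstance, _, _, ?_, hFG.trans h1, ?_⟩
  · intro e e' he
    exact Subtype.ext he
  · refine ⟨_, comp_mem_matchPoly hj hyP (by simp), fun e => ?_⟩
    exact lt_of_le_of_ne (hyP.1 _) e.2.symm

end Birkhoff

-- Elementary graphs and the dimension formula.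

section Elementary

variable {A B E : Type} [Fintype E]

/-- A bipartite multigraph that is nonempty, connected, and has a fractional perfect matching with
full support. -/
structure IsElementary (l : E → A) (r : E → B) : Prop where
  nonempty : Nonempty A
  connected : ∀ (S : Set A) (T : Set B), (∀ e, l e ∈ S ↔ r e ∈ T) →
    (S = ∅ ∧ T = ∅) ∨ (S = univ ∧ T = univ)
  exists_pos : ∃ x ∈ matchPoly l r, ∀ e, 0 < x e

variable {l : E → A} {r : E → B}

theorem exists_edge_of_mem_matchPoly {x : E → ℝ} (hx : x ∈ matchPoly l r) (a : A) :
    ∃ e, l e = a := by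
  by_contra h
  push Not at h
  have := hx.2.1 a
  simp [fiberSum, h] at this

namespace IsElementary

theorem matchPoly_nonempty (h : IsElementary l r) : (matchPoly l r).Nonempty :=
  h.exists_pos.imp fun _ hx => hx.1

theorem symm (h : IsElementary l r) : IsElementary r l := by
  obtain ⟨x, hx, hpos⟩ := h.exists_pos
  refine ⟨?_, fun S T hST => ?_, x, matchPoly_comm l r ▸ hx, hpos⟩
  · obtain ⟨a⟩ := h.nonempty
    obtain ⟨e, -⟩ := exists_edge_of_mem_matchPoly hx a
    exact ⟨r e⟩
  · rcases h.connected T S fun e => (hST e).symm with h | h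
    exacts [Or.inl h.symm, Or.inr h.symm]

theorem eq_const (h : IsElementary l r) {p : A → ℝ} {q : B → ℝ} (hpq : ∀ e, p (l e) = q (r e)) :
    ∃ c, (∀ a, p a = c) ∧ ∀ b, q b = c := by
  obtain ⟨a⟩ := h.nonempty
  refine ⟨p a, ?_⟩
  rcases h.connected {a' | p a' = p a} {b | q b = p a} (fun e => by simp [hpq]) with h | h
  · exact absurd h.1 (Set.Nonempty.ne_empty ⟨a, rfl⟩)
  · exact ⟨fun a' => (h.1 ▸ mem_univ a' : a' ∈ {a' | p a' = p a}),
      fun b => (h.2 ▸ mem_univ b : b ∈ {b | q b = p a})⟩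

/-- If `a` had a single neighbor, the weight 1 at that neighbor would already be used up by `a`.
Positivity leaves no other edge there, so the two vertices form a component. -/
theorem exists_two_neighbors [Fintype A] (h : IsElementary l r) (hA : 2 ≤ Fintype.card A) (a : A) :
    ∃ e e', l e = a ∧ l e' = a ∧ r e ≠ r e' := by
  classical
  obtain ⟨x, hx, hpos⟩ := h.exists_pos
  obtain ⟨e, he⟩ := exists_edge_of_mem_matchPoly hx a
  by_contra hcon
  push Not at hcon
  have h1 : ∀ e', l e' = a → r e' = r e := fun e' he' => hcon e' e he' he
  have h2 : ∀ e', r e' = r e → l e' = a := by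
    have hs : ∑ e', ((if r e' = r e then x e' else 0) - if l e' = a then x e' else 0) = 0 := by
      rw [Finset.sum_sub_distrib, ← fiberSum_def, ← fiberSum_def, hx.2.1, hx.2.2, sub_self]
    rw [Finset.sum_eq_zero_iff_of_nonneg] at hs
    · intro e' he'
      by_contra hne
      have := hs e' (Finset.mem_univ _)
      simp only [he', hne, if_true, if_false, sub_zero] at this
      exact (hpos e').ne' this
    · intro e' _
      by_cases hl : l e' = a
      · simp [hl, h1 e' hl]
      · simp only [hl, if_false, sub_zero]
        split_ifs
        exacts [hx.1 e', le_rfl]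
  rcases h.connected {a} {r e} (fun e' => ⟨h1 e', h2 e'⟩) with h | h
  · exact absurd h.1 (singleton_ne_empty a)
  · have : Fintype.card A ≤ 1 := by
      rw [Fintype.card_le_one_iff]
      intro u v
      have hu : u ∈ ({a} : Set A) := h.1 ▸ mem_univ u
      have hv : v ∈ ({a} : Set A) := h.1 ▸ mem_univ v
      rw [mem_singleton_iff.1 hu, mem_singleton_iff.1 hv]
    omega

end IsElementary

theorem finrank_vectorSpan_matchPoly (h : ∃ x ∈ matchPoly l r, ∀ e, 0 < x e) :
    Module.finrank ℝ (vectorSpan ℝ (matchPoly l r)) = Module.finrank ℝ (balanced l r) := by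
  obtain ⟨x, hx, hpos⟩ := h
  have h1 := matchPoly_eq_nonnegSlice hx
  have h2 : x ∈ nonnegSlice (balanced l r) x := h1 ▸ hx
  have h3 : {z ∈ nonnegSlice (balanced l r) x | ∀ i, x i = 0 → z i = 0} = matchPoly l r := by
    rw [h1]
    ext z
    exact ⟨fun h => h.1, fun h => ⟨h, fun i hi => absurd hi (hpos i).ne'⟩⟩
  have h4 : supportedIn (balanced l r) x = balanced l r := by
    ext z
    exact ⟨fun h => h.1, fun h => ⟨h, fun i hi => absurd hi (hpos i).ne'⟩⟩
  rw [← h3, vectorSpan_zeroSet h2, h4]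

open Classical in
/-- The vertex-edge incidence matrix. -/
noncomputable def incidence (l : E → A) (r : E → B) : Matrix (A ⊕ B) E ℝ :=
  Matrix.of fun v e => Sum.elim (fun a => if l e = a then 1 else 0)
    (fun b => if r e = b then 1 else 0) v

/-- The direction space is the kernel of the incidence matrix. By connectedness, the only relation
among its rows, up to scaling, is that left and right rows have the same total, so the rank is one
less than the number of vertices. -/
theorem IsElementary.finrank_add_card [Fintype A] [Fintype B] (h : IsElementary l r) :
    Module.finrank ℝ (vectorSpan ℝ (matchPoly l r)) + (Fintype.card A + Fintype.card B) =
      Fintype.card E + 1 := by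
  classical
  rw [finrank_vectorSpan_matchPoly h.exists_pos]
  have hker : LinearMap.ker (incidence l r).mulVecLin = balanced l r := by
    ext x
    rw [LinearMap.mem_ker, Matrix.mulVecLin_apply]
    change _ ↔ (∀ a, _ = (0 : ℝ)) ∧ ∀ b, _ = (0 : ℝ)
    rw [funext_iff, Sum.forall]
    simp [incidence, Matrix.mulVec, dotProduct, fiberSum_def]
  have hkerT : Module.finrank ℝ (LinearMap.ker (incidence l r).transpose.mulVecLin) = 1 := by
    have hmem : ∀ w : A ⊕ B → ℝ, w ∈ LinearMap.ker (incidence l r).transpose.mulVecLin ↔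
        ∀ e, w (Sum.inl (l e)) + w (Sum.inr (r e)) = 0 := by
      intro w
      rw [LinearMap.mem_ker, Matrix.mulVecLin_apply, funext_iff]
      simp [incidence, Matrix.mulVec, dotProduct]
    refine (finrank_eq_one_iff_of_nonzero'
      (⟨Sum.elim (fun _ => 1) fun _ => -1, by rw [hmem]; simp⟩ :
        LinearMap.ker (incidence l r).transpose.mulVecLin) ?_).2 ?_
    · intro h0
      obtain ⟨a⟩ := h.nonempty
      have := congrFun (congrArg Subtype.val h0) (Sum.inl a)
      simp at this
    · rintro ⟨w, hw⟩
      rw [hmem] at hw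
      obtain ⟨c, hc, hc'⟩ := h.eq_const (p := fun a => w (Sum.inl a))
        (q := fun b => -w (Sum.inr b)) (fun e => by linarith [hw e])
      refine ⟨c, Subtype.ext (funext ?_)⟩
      rintro (a | b)
      · simpa using (hc a).symm
      · have := hc' b
        simp
        linarith
  have h1 := LinearMap.finrank_range_add_finrank_ker (incidence l r).mulVecLin
  have h2 := LinearMap.finrank_range_add_finrank_ker (incidence l r).transpose.mulVecLin
  have h3 := Matrix.rank_transpose (incidence l r)
  rw [Matrix.rank, Matrix.rank] at h3
  rw [hker] at h1
  rw [hkerT, h3] at h2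
  simp only [Module.finrank_fintype_fun_eq_card, Fintype.card_sum] at h1 h2
  omega

end Elementary

-- Contracting a vertex of degree two, and its inverse.

section Contraction

set_option linter.unusedSectionVars false

variable {A B E A' B' E' : Type} [Fintype E] [Fintype E']

/-- Two multigraphs, the second of which arises from the first by deleting the vertex `v`, whose
only edges are `e₁` and `e₂`, and identifying the two neighbors of `v`. -/
structure IsContraction (l : E → A) (r : E → B) (l' : E' → A') (r' : E' → B') (i : E' → E)
    (α : A' → A) (β : B → B') (v : A) (e₁ e₂ : E) : Prop where
  ne : e₁ ≠ e₂
  left_eq_iff : ∀ e, l e = v ↔ e = e₁ ∨ e = e₂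
  edge_injective : i.Injective
  edge_surjective : ∀ e, l e ≠ v → ∃ e', i e' = e
  left_comm : ∀ e, l (i e) = α (l' e)
  left_injective : α.Injective
  left_ne : ∀ a, α a ≠ v
  left_surjective : ∀ a, a ≠ v → ∃ a', α a' = a
  right_comm : ∀ e, r' e = β (r (i e))
  right_ne : r e₁ ≠ r e₂
  right_surjective : β.Surjective
  right_eq_iff : ∀ b b', β b = β b' ↔ b = b' ∨ (b = r e₁ ∧ b' = r e₂) ∨ (b = r e₂ ∧ b' = r e₁)

namespace IsContraction

variable {l : E → A} {r : E → B} {l' : E' → A'} {r' : E' → B'} {i : E' → E}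
  {α : A' → A} {β : B → B'} {v : A} {e₁ e₂ : E}

theorem edge_ne (h : IsContraction l r l' r' i α β v e₁ e₂) (e : E') : i e ≠ e₁ ∧ i e ≠ e₂ := by
  have h1 : l (i e) ≠ v := h.left_comm e ▸ h.left_ne _
  rw [Ne, h.left_eq_iff] at h1
  tauto

theorem edge_cases (h : IsContraction l r l' r' i α β v e₁ e₂) (e : E) :
    e = e₁ ∨ e = e₂ ∨ ∃ e', i e' = e := by
  by_cases hl : l e = v
  · rcases (h.left_eq_iff e).1 hl with h | h
    exacts [Or.inl h, Or.inr (Or.inl h)]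
  · exact Or.inr (Or.inr (h.edge_surjective e hl))

theorem sum_eq (h : IsContraction l r l' r' i α β v e₁ e₂) (f : E → ℝ) :
    ∑ e, f e = f e₁ + f e₂ + ∑ e, f (i e) := by
  classical
  rw [← Finset.sum_pair h.ne, ← Finset.sum_add_sum_compl {e₁, e₂} f]
  congr 1
  refine (Finset.sum_bij (fun e _ => i e) ?_ ?_ ?_ fun _ _ => rfl).symm
  · intro e _
    simpa using h.edge_ne e
  · exact fun a _ b _ hab => h.edge_injective hab
  · intro e he
    simp only [Finset.mem_compl, Finset.mem_insert, Finset.mem_singleton, not_or] at he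
    rcases h.edge_cases e with h' | h' | ⟨e', h'⟩
    exacts [absurd h' he.1, absurd h' he.2, ⟨e', Finset.mem_univ _, h'⟩]

theorem fiberSum_left_self (h : IsContraction l r l' r' i α β v e₁ e₂) (x : E → ℝ) :
    fiberSum l v x = x e₁ + x e₂ := by
  classical
  rw [fiberSum_def, h.sum_eq]
  simp [(h.left_eq_iff e₁).2 (Or.inl rfl), (h.left_eq_iff e₂).2 (Or.inr rfl), h.left_comm,
    h.left_ne]

theorem fiberSum_left (h : IsContraction l r l' r' i α β v e₁ e₂) (x : E → ℝ) (a : A') :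
    fiberSum l (α a) x = fiberSum l' a (x ∘ i) := by
  classical
  rw [fiberSum_def, h.sum_eq, fiberSum_def]
  simp [(h.left_eq_iff e₁).2 (Or.inl rfl), (h.left_eq_iff e₂).2 (Or.inr rfl), h.left_comm,
    (h.left_ne a).symm, h.left_injective.eq_iff]

theorem fiberSum_right₁ (h : IsContraction l r l' r' i α β v e₁ e₂) (x : E → ℝ) :
    fiberSum r (r e₁) x = x e₁ + fiberSum (r ∘ i) (r e₁) (x ∘ i) := by
  classical
  rw [fiberSum_def, h.sum_eq, fiberSum_def]
  simp [h.right_ne.symm]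

theorem fiberSum_right₂ (h : IsContraction l r l' r' i α β v e₁ e₂) (x : E → ℝ) :
    fiberSum r (r e₂) x = x e₂ + fiberSum (r ∘ i) (r e₂) (x ∘ i) := by
  classical
  rw [fiberSum_def, h.sum_eq, fiberSum_def]
  simp [h.right_ne]

theorem fiberSum_right (h : IsContraction l r l' r' i α β v e₁ e₂) (x : E → ℝ) (b : B)
    (h1 : b ≠ r e₁) (h2 : b ≠ r e₂) : fiberSum r b x = fiberSum r' (β b) (x ∘ i) := by
  classical
  rw [fiberSum_def, h.sum_eq, fiberSum_def]
  simp only [h1.symm, h2.symm, if_false, zero_add, h.right_comm, h.right_eq_iff]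
  simp [h1, h2]

theorem fiberSum_merged (h : IsContraction l r l' r' i α β v e₁ e₂) (y : E' → ℝ) :
    fiberSum r' (β (r e₁)) y = fiberSum (r ∘ i) (r e₁) y + fiberSum (r ∘ i) (r e₂) y := by
  classical
  simp only [fiberSum_def, ← Finset.sum_add_distrib, h.right_comm, h.right_eq_iff]
  refine Finset.sum_congr rfl fun e _ => ?_
  by_cases h1 : r (i e) = r e₁
  · simp [h1, h.right_ne]
  · by_cases h2 : r (i e) = r e₂
    · simp [h2, h.right_ne.symm]
    · simp [h1, h2]

theorem eq_of_right_eq (h : IsContraction l r l' r' i α β v e₁ e₂) : β (r e₂) = β (r e₁) :=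
  (h.right_eq_iff _ _).2 (Or.inr (Or.inr ⟨rfl, rfl⟩))

theorem comp_mem (h : IsContraction l r l' r' i α β v e₁ e₂) {x : E → ℝ}
    (hx : x ∈ matchPoly l r) : x ∘ i ∈ matchPoly l' r' := by
  refine ⟨fun e => hx.1 _, fun a => by rw [← h.fiberSum_left, hx.2.1], fun b => ?_⟩
  obtain ⟨b, rfl⟩ := h.right_surjective b
  have key : fiberSum r' (β (r e₁)) (x ∘ i) = 1 := by
    rw [h.fiberSum_merged]
    have h1 := hx.2.2 (r e₁)
    have h2 := hx.2.2 (r e₂)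
    have h3 := hx.2.1 v
    rw [h.fiberSum_right₁] at h1
    rw [h.fiberSum_right₂] at h2
    rw [h.fiberSum_left_self] at h3
    linarith
  by_cases h1 : b = r e₁
  · rw [h1, key]
  · by_cases h2 : b = r e₂
    · rw [h2, h.eq_of_right_eq, key]
    · rw [← h.fiberSum_right x b h1 h2, hx.2.2]

/-- The weights of `e₁` and `e₂` are recoverable. Since `x e₁ + x e₂ = 1` and the sums at both
neighbors are 1, the weight of `e₁` equals the total weight of the other edges at `r e₂`, and vice
versa. Written this way, the inverse is linear. -/
theorem affIso (h : IsContraction l r l' r' i α β v e₁ e₂) :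
    AffIso (matchPoly l r) (matchPoly l' r') := by
  classical
  set g : (E' → ℝ) → E → ℝ := fun y e =>
    if e = e₁ then fiberSum (r ∘ i) (r e₂) y
    else if e = e₂ then fiberSum (r ∘ i) (r e₁) y else Function.extend i y 0 e with hg
  have g1 : ∀ y, g y e₁ = fiberSum (r ∘ i) (r e₂) y := fun y => by simp [hg]
  have g2 : ∀ y, g y e₂ = fiberSum (r ∘ i) (r e₁) y := fun y => by simp [hg, h.ne.symm]
  have g3 : ∀ y e, g y (i e) = y e := fun y e => by
    simp [hg, h.edge_ne e, h.edge_injective.extend_apply]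
  have g4 : ∀ y, g y ∘ i = y := fun y => funext (g3 y)
  refine AffIso.of_linear (fun x => x ∘ i) g ⟨fun _ _ => rfl, fun _ _ => rfl⟩ ⟨?_, ?_⟩
    (fun x hx => h.comp_mem hx) ?_ ?_ (fun y _ => g4 y)
  · intro x y
    ext e
    rcases h.edge_cases e with rfl | rfl | ⟨e, rfl⟩
    · simp only [Pi.add_apply, g1, fiberSum_add]
    · simp only [Pi.add_apply, g2, fiberSum_add]
    · simp only [Pi.add_apply, g3]
  · intro c x
    ext e
    rcases h.edge_cases e with rfl | rfl | ⟨e, rfl⟩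
    · simp only [Pi.smul_apply, g1, fiberSum_smul, smul_eq_mul]
    · simp only [Pi.smul_apply, g2, fiberSum_smul, smul_eq_mul]
    · simp only [Pi.smul_apply, g3]
  · intro y hy
    have hnn : ∀ b, 0 ≤ fiberSum (r ∘ i) b y := fun b => by
      rw [fiberSum_def]
      exact Finset.sum_nonneg fun e _ => by
        split_ifs
        exacts [hy.1 e, le_rfl]
    have hm := hy.2.2 (β (r e₁))
    rw [h.fiberSum_merged] at hm
    refine ⟨fun e => ?_, fun a => ?_, fun b => ?_⟩
    · rcases h.edge_cases e with rfl | rfl | ⟨e, rfl⟩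
      · rw [g1]; exact hnn _
      · rw [g2]; exact hnn _
      · rw [g3]; exact hy.1 e
    · by_cases ha : a = v
      · rw [ha, h.fiberSum_left_self, g1, g2]
        linarith
      · obtain ⟨a, rfl⟩ := h.left_surjective a ha
        rw [h.fiberSum_left, g4, hy.2.1]
    · by_cases h1 : b = r e₁
      · rw [h1, h.fiberSum_right₁, g4, g1]
        linarith
      · by_cases h2 : b = r e₂
        · rw [h2, h.fiberSum_right₂, g4, g2]
          linarith
        · rw [h.fiberSum_right _ b h1 h2, g4, hy.2.2]
  · intro x hx
    have h1 := hx.2.2 (r e₁)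
    have h2 := hx.2.2 (r e₂)
    have h3 := hx.2.1 v
    rw [h.fiberSum_right₁] at h1
    rw [h.fiberSum_right₂] at h2
    rw [h.fiberSum_left_self] at h3
    ext e
    rcases h.edge_cases e with rfl | rfl | ⟨e, rfl⟩
    · rw [g1]; linarith
    · rw [g2]; linarith
    · rw [g3]; rfl

/-- A union of components of the contracted graph lifts to one of the original graph; `v` is
included exactly when the merged vertex is. -/
theorem isElementary (h : IsContraction l r l' r' i α β v e₁ e₂) (hG : IsElementary l r)
    (hne : Nonempty A') : IsElementary l' r' := by
  obtain ⟨x, hx, hpos⟩ := hG.exists_pos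
  refine ⟨hne, fun S T hST => ?_, x ∘ i, h.comp_mem hx, fun e => hpos _⟩
  have hv1 := (h.left_eq_iff e₁).2 (Or.inl rfl)
  have hv2 := (h.left_eq_iff e₂).2 (Or.inr rfl)
  have hS : ∀ a, α a ∈ α '' S ∪ {w | w = v ∧ β (r e₁) ∈ T} ↔ a ∈ S := by
    intro a
    simp [h.left_ne, h.left_injective.mem_set_image]
  have hv : v ∈ α '' S ∪ {w | w = v ∧ β (r e₁) ∈ T} ↔ β (r e₁) ∈ T := by
    simp [h.left_ne]
  have hcl : ∀ e, l e ∈ α '' S ∪ {w | w = v ∧ β (r e₁) ∈ T} ↔ r e ∈ β ⁻¹' T := by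
    intro e
    rcases h.edge_cases e with rfl | rfl | ⟨e, rfl⟩
    · rw [hv1, hv]; rfl
    · rw [hv2, hv, mem_preimage, h.eq_of_right_eq]
    · rw [h.left_comm, hS, hST, h.right_comm]; rfl
  rcases hG.connected _ _ hcl with ⟨h1, h2⟩ | ⟨h1, h2⟩
  · left
    constructor
    · ext a
      rw [← hS, h1]
      simp
    · rw [← image_preimage_eq T h.right_surjective, h2, image_empty]
  · right
    constructor
    · ext a
      rw [← hS, h1]
      simp
    · rw [← image_preimage_eq T h.right_surjective, h2, image_univ, h.right_surjective.range_eq]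

end IsContraction

theorem exists_isContraction {l : E → A} {r : E → B} {v : A} {e₁ e₂ : E}
    (hv : ∀ e, l e = v ↔ e = e₁ ∨ e = e₂) (hne : r e₁ ≠ r e₂) :
    ∃ (l' : {e // l e ≠ v} → {a // a ≠ v}) (r' : {e // l e ≠ v} → {b // b ≠ r e₂})
      (β : B → {b // b ≠ r e₂}), IsContraction l r l' r' Subtype.val Subtype.val β v e₁ e₂ := by
  classical
  refine ⟨fun e => ⟨l e, e.2⟩, fun e => if h : r e = r e₂ then ⟨r e₁, hne⟩ else ⟨r e, h⟩,
    fun b => if h : b = r e₂ then ⟨r e₁, hne⟩ else ⟨b, h⟩, fun h => hne (by rw [h]), hv,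
    Subtype.val_injective, fun e he => ⟨⟨e, he⟩, rfl⟩, fun _ => rfl, Subtype.val_injective,
    fun a => a.2, fun a ha => ⟨⟨a, ha⟩, rfl⟩, fun _ => rfl, hne,
    fun b => ⟨b, by simp [b.2]⟩, fun b b' => ?_⟩
  by_cases h1 : b = r e₂ <;> by_cases h2 : b' = r e₂
  · simp [h1, h2]
  · simp [h1, h2, Ne.symm h2, hne.symm, eq_comm]
  · simp [h1, h2, hne.symm]
  · simp [h1, h2]

open Classical in
/-- The right endpoint map after splitting off the edges in `X` from `b`. -/
noncomputable def splitRight (r : E → B) (b : B) (X : Set E) : E ⊕ Bool → Option B :=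
  Sum.elim (fun e => if e ∈ X then none else some (r e)) fun t => if t then none else some b

/-- The left endpoint map after adding a left vertex with two edges. -/
def splitLeft (l : E → A) : E ⊕ Bool → Option A :=
  Sum.elim (fun e => some (l e)) fun _ => none

theorem isContraction_split (l : E → A) (r : E → B) (b : B) (X : Set E) (hX : ∀ e ∈ X, r e = b) :
    IsContraction (splitLeft l) (splitRight r b X) l r Sum.inl some (fun o => o.getD b) none
      (Sum.inr true) (Sum.inr false) where
  ne := by simp
  left_eq_iff := by simp [splitLeft]
  edge_injective := Sum.inl_injective
  edge_surjective := by simp [splitLeft]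
  left_comm := fun _ => rfl
  left_injective := Option.some_injective _
  left_ne := by simp
  left_surjective := by
    rintro (_ | a) h
    exacts [absurd rfl h, ⟨a, rfl⟩]
  right_comm := by
    intro e
    by_cases he : e ∈ X
    · simp [splitRight, he, hX]
    · simp [splitRight, he]
  right_ne := by simp [splitRight]
  right_surjective := fun b' => ⟨some b', rfl⟩
  right_eq_iff := by
    rintro (_ | c) (_ | c') <;> simp [splitRight, eq_comm]

end Contraction

-- Reduction to minimum degree three.

section Degree

variable {A B E : Type} [Fintype E]

open Classical in
/-- The number of edges at the vertex `a`. -/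
noncomputable def degree (l : E → A) (a : A) : ℕ :=
  (Finset.univ.filter fun e => l e = a).card

theorem sum_degree [Fintype A] (l : E → A) : ∑ a, degree l a = Fintype.card E := by
  classical
  rw [← Finset.card_univ, Finset.card_eq_sum_card_fiberwise (f := l) (t := Finset.univ) (by simp)]
  exact Finset.sum_congr rfl fun a _ => by unfold degree; congr

end Degree

/-- There are at least two distinct neighbors, so a degree below 3 means exactly two edges, with
different ends. -/
theorem IsElementary.exists_contraction {A B E : Type} [Fintype A] [Fintype B] [Fintype E]
    {l : E → A} {r : E → B} (h : IsElementary l r) (hA : 2 ≤ Fintype.card A) {a : A}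
    (ha : degree l a < 3) :
    ∃ (A' B' E' : Type) (_ : Fintype A') (_ : Fintype B') (_ : Fintype E') (l' : E' → A')
      (r' : E' → B'), IsElementary l' r' ∧ AffIso (matchPoly l r) (matchPoly l' r') ∧
        Fintype.card A' + 1 = Fintype.card A := by
  classical
  obtain ⟨e₁, e₂, h1, h2, hne⟩ := h.exists_two_neighbors hA a
  have hv : ∀ e, l e = a ↔ e = e₁ ∨ e = e₂ := by
    have hsub : ({e₁, e₂} : Finset E) ⊆ Finset.univ.filter fun e => l e = a := by
      simp [Finset.insert_subset_iff, h1, h2]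
    have hcard : ({e₁, e₂} : Finset E).card = 2 :=
      Finset.card_pair fun h => hne (by rw [h])
    have heq := Finset.eq_of_subset_of_card_le hsub (by
      unfold degree at ha
      rw [hcard]
      convert Nat.le_of_lt_succ ha using 2)
    intro e
    have : e ∈ ({e₁, e₂} : Finset E) ↔ e ∈ Finset.univ.filter fun e => l e = a := by rw [heq]
    simpa using this.symm
  obtain ⟨l', r', β, hc⟩ := exists_isContraction hv hne
  have hcard : Fintype.card {a' // a' ≠ a} + 1 = Fintype.card A := by
    have := Fintype.card_subtype_compl (fun a' => a' = a)
    rw [Fintype.card_subtype_eq] at this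
    have h' : Fintype.card {a' // a' ≠ a} = Fintype.card {a' // ¬ a' = a} := rfl
    omega
  have hne' : Nonempty {a' // a' ≠ a} := by
    rw [← Fintype.card_pos_iff]
    omega
  exact ⟨_, _, _, inferInstance, inferInstance, inferInstance, l', r',
    hc.isElementary h hne', hc.affIso, hcard⟩

/-- Contraction on either side removes one vertex from each side, so the process stops. Parallel
edges may arise on the way, which is why multigraphs are used. -/
theorem IsElementary.exists_reduced {A B E : Type} [Fintype A] [Fintype B] [Fintype E]
    {l : E → A} {r : E → B} (h : IsElementary l r) :
    ∃ (A' B' E' : Type) (_ : Fintype A') (_ : Fintype B') (_ : Fintype E') (l' : E' → A')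
      (r' : E' → B'), IsElementary l' r' ∧ AffIso (matchPoly l r) (matchPoly l' r') ∧
        (Fintype.card A' = 1 ∨ 2 ≤ Fintype.card A' ∧ (∀ a, 3 ≤ degree l' a) ∧
          ∀ b, 3 ≤ degree r' b) := by
  induction hn : Fintype.card A using Nat.strong_induction_on generalizing A B E with
  | _ n ih =>
    by_cases h1 : Fintype.card A = 1
    · exact ⟨A, B, E, inferInstance, inferInstance, inferInstance, l, r, h,
        AffIso.refl _, Or.inl h1⟩
    have hA : 2 ≤ Fintype.card A := by
      have := h.nonempty
      have := Fintype.card_pos (α := A)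
      omega
    have hAB := card_eq_of_matchPoly_nonempty h.matchPoly_nonempty
    by_cases hl : ∀ a, 3 ≤ degree l a
    · by_cases hr : ∀ b, 3 ≤ degree r b
      · exact ⟨A, B, E, inferInstance, inferInstance, inferInstance, l, r, h,
        AffIso.refl _, Or.inr ⟨hA, hl, hr⟩⟩
      · push Not at hr
        obtain ⟨b, hb⟩ := hr
        obtain ⟨B', A', E', _, _, _, r', l', h', hiso, hcard⟩ :=
          h.symm.exists_contraction (by omega) hb
        obtain ⟨A'', B'', E'', iA, iB, iE, l'', r'', h'', hiso', hd⟩ := ih _ (by omega) h' rfl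
        rw [matchPoly_comm] at hiso
        exact ⟨A'', B'', E'', iA, iB, iE, l'', r'', h'', hiso.trans hiso', hd⟩
    · push Not at hl
      obtain ⟨a, ha⟩ := hl
      obtain ⟨A', B', E', _, _, _, l', r', h', hiso, hcard⟩ := h.exists_contraction hA ha
      obtain ⟨A'', B'', E'', iA, iB, iE, l'', r'', h'', hiso', hd⟩ := ih _ (by omega) h' rfl
      exact ⟨A'', B'', E'', iA, iB, iE, l'', r'', h'', hiso.trans hiso', hd⟩

-- Separating parallel edges to regain simple graphs.

section Splitting

/-- The number of adjacent pairs of vertices. -/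
noncomputable def numPairs {A B E : Type} (l : E → A) (r : E → B) : ℕ :=
  (range fun e => (l e, r e)).ncard

/-- The old pairs survive because the parallel edge `e'` stays in place. The moved edge and the two
edges at the new left vertex give three new pairs. -/
theorem numPairs_split {A B E : Type} [Fintype E] {l : E → A} {r : E → B}
    {e e' : E} (hne : e ≠ e') (hl : l e = l e') (hr : r e = r e') :
    numPairs l r + 3 ≤ numPairs (splitLeft l) (splitRight r (r e) {e}) := by
  classical
  set s : Set (Option A × Option B) := Prod.map some some '' range fun e => (l e, r e) with hs
  have hsn : s.ncard = numPairs l r :=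
    ncard_image_of_injective _ ((Option.some_injective _).prodMap (Option.some_injective _))
  have hfin : s.Finite := (finite_range _).image _
  have h1 : ((some (l e), none) : Option A × Option B) ∉ s := by simp [hs]
  have h2 : ((none, none) : Option A × Option B) ∉ insert (some (l e), none) s := by simp [hs]
  have h3 : ((none, some (r e)) : Option A × Option B) ∉
    insert (none, none) (insert (some (l e), none) s) := by simp [hs]
  have hcard : (insert (none, some (r e)) (insert (none, none)
      (insert (some (l e), none) s))).ncard = numPairs l r + 3 := by
    rw [ncard_insert_of_notMem h3 ((hfin.insert _).insert _),
      ncard_insert_of_notMem h2 (hfin.insert _), ncard_insert_of_notMem h1 hfin, hsn]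
  rw [← hcard]
  refine ncard_le_ncard ?_ (finite_range _)
  rintro _ (rfl | rfl | rfl | ⟨_, ⟨f, rfl⟩, rfl⟩)
  · exact ⟨Sum.inr false, by simp [splitLeft, splitRight]⟩
  · exact ⟨Sum.inr true, by simp [splitLeft, splitRight]⟩
  · exact ⟨Sum.inl e, by simp [splitLeft, splitRight]⟩
  · by_cases hf : f = e
    · exact ⟨Sum.inl e', by simp [splitLeft, splitRight, hne.symm, hf, hl, hr]⟩
    · exact ⟨Sum.inl f, by simp [splitLeft, splitRight, hf]⟩

/-- A split adds two edges but at least three adjacent pairs, so the surplus of edges over pairs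
drops by at least one per added vertex. -/
theorem realizable_matchPoly {A B E : Type} [Fintype A] [Fintype B] [Fintype E]
    (l : E → A) (r : E → B) (hAB : Fintype.card B = Fintype.card A) {k : ℕ}
    (hk : Fintype.card E ≤ numPairs l r + k) :
    Realizable (Fintype.card A + k) (matchPoly l r) := by
  induction k generalizing A B E with
  | zero =>
    refine ⟨A, B, E, _, _, _, l, r, le_rfl, hAB, ?_, AffIso.refl _⟩
    rw [← injOn_univ]
    refine injOn_of_ncard_image_eq (le_antisymm (ncard_image_le finite_univ) ?_) finite_univ
    rw [image_univ, ncard_univ, Nat.card_eq_fintype_card]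
    exact hk
  | succ k ih =>
    by_cases hinj : Function.Injective fun e => (l e, r e)
    · exact ⟨A, B, E, _, _, _, l, r, by omega, hAB, hinj, AffIso.refl _⟩
    · simp only [Function.Injective, not_forall, Prod.mk.injEq] at hinj
      obtain ⟨e, e', ⟨hl, hr⟩, hne⟩ := hinj
      have h1 := numPairs_split hne hl hr
      obtain ⟨A', B', E', _, _, _, l', r', hA', hB', hinj, hiso⟩ :=
        ih (splitLeft l) (splitRight r (r e) {e}) (by simpa using hAB) (by
          simp only [Fintype.card_sum, Fintype.card_bool]
          omega)
      refine ⟨A', B', E', _, _, _, l', r', ?_, hB', hinj, AffIso.trans ?_ hiso⟩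
      · rw [Fintype.card_option] at hA'
        omega
      · exact (isContraction_split l r (r e) {e} (by simp)).affIso.symm

/-- Separating four parallel edges one at a time would need 4 vertices per side. Labelling them by
`Bool × Bool` and splitting the right vertex by the first bit and the left vertex by the second
separates all four with only two splits. -/
theorem realizable_tetrahedron {A B E : Type} [Fintype A] [Fintype B] [Fintype E]
    (l : E → A) (r : E → B) (hA : Fintype.card A = 1) (hB : Fintype.card B = 1)
    (hE : Fintype.card E = 4) : Realizable 3 (matchPoly l r) := by
  classical
  obtain ⟨a, ha⟩ := Fintype.card_eq_one_iff.1 hA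
  obtain ⟨b, hb⟩ := Fintype.card_eq_one_iff.1 hB
  have ε : E ≃ Bool × Bool := Fintype.equivOfCardEq (by simp [hE])
  have h1 := isContraction_split l r b {e | (ε e).1 = true} (fun e _ => hb _)
  have h2 := isContraction_split (splitRight r b {e | (ε e).1 = true}) (splitLeft l) (some a)
    (Sum.inl '' {e | (ε e).2 = true}) (by
      rintro _ ⟨e, -, rfl⟩
      simp [splitLeft, ha])
  have hiso := h1.affIso.symm
  rw [matchPoly_comm (splitLeft l)] at hiso
  refine ⟨_, _, _, inferInstance, inferInstance, inferInstance, _, _, ?_, ?_, ?_,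
    hiso.trans h2.affIso.symm⟩
  · simp [hB]
  · simp [hA, hB]
  · have hl := fun e => ha (l e)
    have hr := fun e => hb (r e)
    rintro ((e | t) | t) ((e' | t') | t') h
    · rcases h1 : ε e with ⟨_ | _, _ | _⟩ <;> rcases h2 : ε e' with ⟨_ | _, _ | _⟩ <;>
        simp [splitLeft, splitRight, h1, h2, hl, hr] at h <;>
        exact congrArg _ (congrArg _ (ε.injective (h1.trans h2.symm)))
    all_goals
      simp only [splitLeft, splitRight, Sum.elim_inl, Sum.elim_inr, Prod.mk.injEq] at h
      split_ifs at h <;> simp_all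

end Splitting

-- Disjoint unions of graphs and products of polytopes.

section Union

variable {A B E A' B' E' : Type} [Fintype E] [Fintype E']

theorem matchPoly_sum_affIso (l : E → A) (r : E → B) (l' : E' → A') (r' : E' → B') :
    AffIso (matchPoly l r ×ˢ matchPoly l' r') (matchPoly (Sum.map l l') (Sum.map r r')) := by
  have h1 : ∀ {C C' : Type} (m : E → C) (m' : E' → C') (z : E ⊕ E' → ℝ) c,
      fiberSum (Sum.map m m') (Sum.inl c) z = fiberSum m c (z ∘ Sum.inl) :=
    fun m m' z c => fiberSum_of_injective (l := Sum.map m m') (l' := m) Sum.inl_injective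
      Sum.inl_injective (fun _ => rfl) c (by simp)
  have h2 : ∀ {C C' : Type} (m : E → C) (m' : E' → C') (z : E ⊕ E' → ℝ) c,
      fiberSum (Sum.map m m') (Sum.inr c) z = fiberSum m' c (z ∘ Sum.inr) :=
    fun m m' z c => fiberSum_of_injective (l := Sum.map m m') (l' := m') Sum.inr_injective
      Sum.inr_injective (fun _ => rfl) c (by simp)
  have hmem : ∀ z : E ⊕ E' → ℝ, z ∈ matchPoly (Sum.map l l') (Sum.map r r') ↔
      z ∘ Sum.inl ∈ matchPoly l r ∧ z ∘ Sum.inr ∈ matchPoly l' r' := by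
    intro z
    change (_ ∧ _ ∧ _) ↔ (_ ∧ _ ∧ _) ∧ (_ ∧ _ ∧ _)
    simp only [Sum.forall, h1, h2, Function.comp_apply]
    tauto
  refine AffIso.of_linear (fun p => Sum.elim p.1 p.2) (fun z => (z ∘ Sum.inl, z ∘ Sum.inr))
    ⟨fun p q => ?_, fun c p => ?_⟩ ⟨fun _ _ => rfl, fun _ _ => rfl⟩ ?_ ?_ ?_ ?_
  · ext (e | e) <;> rfl
  · ext (e | e) <;> rfl
  · intro p hp
    exact (hmem _).2 hp
  · intro z hz
    exact (hmem _).1 hz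
  · intro p _
    rfl
  · intro z _
    ext (e | e) <;> rfl

theorem Realizable.prod {V W : Type*} [AddCommGroup V] [Module ℝ V] [AddCommGroup W] [Module ℝ W]
    {P : Set V} {Q : Set W} {m n : ℕ} (hP : Realizable m P) (hQ : Realizable n Q) :
    Realizable (m + n) (P ×ˢ Q) := by
  obtain ⟨A, B, E, _, _, _, l, r, hA, hB, hinj, hiso⟩ := hP
  obtain ⟨A', B', E', _, _, _, l', r', hA', hB', hinj', hiso'⟩ := hQ
  refine ⟨_, _, _, inferInstance, inferInstance, inferInstance, _, _, ?_, ?_, ?_,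
    (hiso.prod hiso').trans (matchPoly_sum_affIso l r l' r')⟩
  · rw [Fintype.card_sum]
    omega
  · rw [Fintype.card_sum, Fintype.card_sum, hB, hB']
  · rintro (e | e) (e' | e') h
    · exact congrArg _ (hinj (by simpa using h))
    · simp at h
    · simp at h
    · exact congrArg _ (hinj' (by simpa using h))

theorem Realizable.of_affIso {V W : Type*} [AddCommGroup V] [Module ℝ V] [AddCommGroup W]
    [Module ℝ W] {P : Set V} {Q : Set W} {m : ℕ} (hP : Realizable m P) (h : AffIso P Q) :
    Realizable m Q := by
  obtain ⟨A, B, E, _, _, _, l, r, hA, hB, hinj, hiso⟩ := hP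
  exact ⟨A, B, E, _, _, _, l, r, hA, hB, hinj, h.symm.trans hiso⟩

variable {l : E → A} {r : E → B} {S : Set A} {T : Set B}

/-- The restriction of an endpoint map to the edges with left end in `S`. -/
def restrictEnd {C : Type} (l : E → A) (m : E → C) (S : Set A) (U : Set C)
    (h : ∀ e, l e ∈ S → m e ∈ U) (e : {e // l e ∈ S}) : U :=
  ⟨m e, h e e.2⟩

theorem comp_mem_matchPoly_restrictEnd [Fintype {e // l e ∈ S}] (h : ∀ e, l e ∈ S ↔ r e ∈ T) {x : E → ℝ}
    (hx : x ∈ matchPoly l r) : x ∘ Subtype.val ∈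
      matchPoly (restrictEnd l l S S fun _ h => h) (restrictEnd l r S T fun e => (h e).1) := by
  refine ⟨fun e => hx.1 _, fun a => ?_, fun b => ?_⟩
  · rw [← fiberSum_of_injective (l := l) Subtype.val_injective Subtype.val_injective
      (fun _ => rfl) a, hx.2.1]
    intro e he hea
    exact absurd ⟨⟨e, hea ▸ a.2⟩, rfl⟩ he
  · rw [← fiberSum_of_injective (l := r) Subtype.val_injective Subtype.val_injective
      (fun _ => rfl) b, hx.2.2]
    intro e he hea
    exact absurd ⟨⟨e, (h e).2 (hea ▸ b.2)⟩, rfl⟩ he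

theorem matchPoly_affIso_prod [Fintype {e // l e ∈ S}] [Fintype {e // l e ∈ Sᶜ}]
    (h : ∀ e, l e ∈ S ↔ r e ∈ T) (h' : ∀ e, l e ∈ Sᶜ ↔ r e ∈ Tᶜ) :
    AffIso (matchPoly l r)
      (matchPoly (restrictEnd l l S S fun _ h => h) (restrictEnd l r S T fun e => (h e).1) ×ˢ
      matchPoly (restrictEnd l l Sᶜ Sᶜ fun _ h => h)
        (restrictEnd l r Sᶜ Tᶜ fun e => (h' e).1)) := by
  classical
  refine AffIso.trans ?_ (matchPoly_sum_affIso _ _ _ _).symm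
  set j : {e // l e ∈ S} ⊕ {e // l e ∈ Sᶜ} → E := Sum.elim Subtype.val Subtype.val with hjdef
  have hj : j.Injective := Subtype.val_injective.sumElim Subtype.val_injective
    fun e e' he => e'.2 (he ▸ e.2)
  have hj' : range j = univ := by
    ext e
    simp [hjdef, Set.Sum.elim_range, _root_.em]
  have h1 := matchPoly_zeroSet_affIso l r hj
  have h2 : {x ∈ matchPoly l r | ∀ e ∈ (range j)ᶜ, x e = 0} = matchPoly l r := by
    simp [hj']
  rw [h2] at h1
  have h3 := matchPoly_equiv_comp (Sum.map (restrictEnd l l S S fun _ h => h)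
    (restrictEnd l l Sᶜ Sᶜ fun _ h => h)) (Sum.map (restrictEnd l r S T fun e => (h e).1)
    (restrictEnd l r Sᶜ Tᶜ fun e => (h' e).1)) (Equiv.Set.sumCompl S) (Equiv.Set.sumCompl T)
  rw [← h3]
  have hl : Equiv.Set.sumCompl S ∘ Sum.map (restrictEnd l l S S fun _ h => h)
      (restrictEnd l l Sᶜ Sᶜ fun _ h => h) = l ∘ j := by
    ext (e | e) <;> simp [restrictEnd, hjdef]
  have hr : Equiv.Set.sumCompl T ∘ Sum.map (restrictEnd l r S T fun e => (h e).1)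
      (restrictEnd l r Sᶜ Tᶜ fun e => (h' e).1) = r ∘ j := by
    ext (e | e) <;> simp [restrictEnd, hjdef]
  rw [hl, hr]
  exact h1

end Union

theorem finrank_vectorSpan_prod {V W : Type*} [AddCommGroup V] [Module ℝ V] [AddCommGroup W]
    [Module ℝ W] [FiniteDimensional ℝ V] [FiniteDimensional ℝ W] {P : Set V} {Q : Set W}
    (hP : P.Nonempty) (hQ : Q.Nonempty) :
    Module.finrank ℝ (vectorSpan ℝ (P ×ˢ Q)) =
      Module.finrank ℝ (vectorSpan ℝ P) + Module.finrank ℝ (vectorSpan ℝ Q) := by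
  rw [vectorSpan_prod_eq hP hQ, ← Module.finrank_prod]
  exact LinearEquiv.finrank_eq
    { toFun := fun x => (⟨x.1.1, x.2.1⟩, ⟨x.1.2, x.2.2⟩)
      invFun := fun x => ⟨(x.1, x.2), x.1.2, x.2.2⟩
      map_add' := fun _ _ => rfl
      map_smul' := fun _ _ => rfl
      left_inv := fun _ => rfl
      right_inv := fun _ => rfl }

-- Inequality descriptions of cubes and pyramids over cubes.

theorem AffIso.of_linear_add {E F : Type*} [AddCommGroup E] [Module ℝ E] [AddCommGroup F]
    [Module ℝ F] {P : Set E} {Q : Set F} (f : E → F) (g : F → E) (c : E) (lf : IsLinearMap ℝ f)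
    (lg : IsLinearMap ℝ g) (hf : MapsTo f P Q) (hg : ∀ y ∈ Q, g y + c ∈ P)
    (hgf : ∀ x ∈ P, g (f x) + c = x) (hfg : ∀ y ∈ Q, f (g y + c) = y) : AffIso P Q :=
  ⟨(IsLinearMap.mk' f lf).toAffineMap,
    (IsLinearMap.mk' g lg).toAffineMap + AffineMap.const ℝ F c, hf, hg, hgf, hfg⟩

theorem mem_cube {d : ℕ} {x : Fin d → ℝ} : x ∈ cube d ↔ ∀ i, 0 ≤ x i ∧ x i ≤ 1 := by
  have : {x : Fin d → ℝ | ∀ i, x i = 0 ∨ x i = 1} = univ.pi fun _ => {0, 1} := by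
    ext x
    simp
  rw [cube, this, convexHull_pi]
  simp [convexHull_pair, segment_eq_Icc, Pi.le_def, forall_and]

theorem mem_pyramid_cube {b : ℕ} {p : (Fin b → ℝ) × ℝ} :
    p ∈ pyramid (cube b) ↔ 0 ≤ p.2 ∧ p.2 ≤ 1 ∧ ∀ i, 0 ≤ p.1 i ∧ p.1 i ≤ 1 - p.2 := by
  constructor
  · intro hp
    refine convexHull_min (t := {p : (Fin b → ℝ) × ℝ |
      0 ≤ p.2 ∧ p.2 ≤ 1 ∧ ∀ i, 0 ≤ p.1 i ∧ p.1 i ≤ 1 - p.2}) ?_ ?_ hp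
    · rintro ⟨x, t⟩ (⟨hx, ht⟩ | h)
      · obtain rfl : t = 0 := ht
        exact ⟨le_rfl, zero_le_one, fun i => by simpa using mem_cube.1 hx i⟩
      · obtain ⟨rfl, rfl⟩ := Prod.mk.inj (mem_singleton_iff.1 h)
        simp
    · rintro ⟨x, s⟩ ⟨hs0, hs1, hx⟩ ⟨y, t⟩ ⟨ht0, ht1, hy⟩ a c ha hc hac
      simp only [Prod.smul_mk, Prod.mk_add_mk, smul_eq_mul, mem_ofPred_eq, Pi.add_apply,
        Pi.smul_apply] at *
      refine ⟨by positivity, by nlinarith, fun i => ⟨?_, ?_⟩⟩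
      · exact add_nonneg (mul_nonneg ha (hx i).1) (mul_nonneg hc (hy i).1)
      · nlinarith [mul_le_mul_of_nonneg_left (hx i).2 ha, mul_le_mul_of_nonneg_left (hy i).2 hc]
  · obtain ⟨x, t⟩ := p
    rintro ⟨ht0, ht1, hx⟩
    dsimp only at ht0 ht1 hx
    have hapex : ((0, 1) : (Fin b → ℝ) × ℝ) ∈ pyramid (cube b) :=
      subset_convexHull ℝ _ (Or.inr rfl)
    rcases ht1.eq_or_lt with rfl | ht
    · have : x = 0 := by
        ext i
        have := hx i
        simp only [sub_self] at this
        exact le_antisymm this.2 this.1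
      rwa [this]
    · have hs : 0 < 1 - t := by linarith
      -- Project from the apex to the base: `(x, t)` lies on the segment from this base point to the
      -- apex.
      have hbase : (((1 - t)⁻¹ • x, 0) : (Fin b → ℝ) × ℝ) ∈ pyramid (cube b) := by
        refine subset_convexHull ℝ _ (Or.inl ⟨mem_cube.2 fun i => ⟨?_, ?_⟩, rfl⟩)
        · exact mul_nonneg (inv_nonneg.2 hs.le) (hx i).1
        · simp only [Pi.smul_apply, smul_eq_mul]
          rw [inv_mul_le_iff₀ hs, mul_one]
          exact (hx i).2
      have := convex_convexHull ℝ _ hbase hapex hs.le ht0 (by ring)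
      rwa [show (1 - t) • (((1 - t)⁻¹ • x, 0) : (Fin b → ℝ) × ℝ) + t • (0, 1) = (x, t) by
        simp [smul_smul, hs.ne']] at this

theorem cube_prod_cube (a b : ℕ) : AffIso (cube a ×ˢ cube b) (cube (a + b)) := by
  refine AffIso.of_linear (fun p => Fin.append p.1 p.2)
    (fun z => (fun i => z (Fin.castAdd b i), fun i => z (Fin.natAdd a i)))
    ⟨fun p q => ?_, fun c p => ?_⟩ ⟨fun _ _ => rfl, fun _ _ => rfl⟩ ?_ ?_ ?_ ?_
  · ext i
    refine Fin.addCases (fun i => ?_) (fun i => ?_) i <;> simp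
  · ext i
    refine Fin.addCases (fun i => ?_) (fun i => ?_) i <;> simp
  · rintro p ⟨h1, h2⟩
    rw [mem_cube] at *
    intro i
    refine Fin.addCases (fun i => ?_) (fun i => ?_) i
    · simpa using h1 i
    · simpa using h2 i
  · intro z hz
    rw [mem_cube] at hz
    exact ⟨mem_cube.2 fun i => hz _, mem_cube.2 fun i => hz _⟩
  · intro p _
    ext i <;> simp
  · intro z _
    ext i
    refine Fin.addCases (fun i => ?_) (fun i => ?_) i <;> simp

theorem affIso_cube_zero {V : Type*} [AddCommGroup V] [Module ℝ V] {P : Set V} (hP : P.Nonempty)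
    (hs : P.Subsingleton) : AffIso P (cube 0) := by
  obtain ⟨p, hp⟩ := hP
  exact ⟨AffineMap.const ℝ V 0, AffineMap.const ℝ _ p, fun _ _ => mem_cube.2 fun i => i.elim0,
    fun _ _ => hp, fun x hx => hs hp hx, fun y _ => Subsingleton.elim _ _⟩

theorem affIso_cube_zero_prod {V : Type*} [AddCommGroup V] [Module ℝ V] (P : Set V) :
    AffIso P (cube 0 ×ˢ P) :=
  AffIso.of_linear (fun x => (0, x)) Prod.snd ⟨fun _ _ => by simp, fun _ _ => by simp⟩
    ⟨fun _ _ => rfl, fun _ _ => rfl⟩ (fun _ hx => ⟨mem_cube.2 fun i => i.elim0, hx⟩)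
    (fun _ hx => hx.2) (fun _ _ => rfl) (fun _ _ => Prod.ext (Subsingleton.elim _ _) rfl)

-- One vertex per side: bundles of parallel edges are simplices.

section Bundle

variable {A B E : Type} [Fintype A] [Fintype B] [Fintype E] (l : E → A) (r : E → B)

theorem matchPoly_eq_stdSimplex (hA : Fintype.card A = 1) (hB : Fintype.card B = 1) :
    matchPoly l r = stdSimplex ℝ E := by
  obtain ⟨a, ha⟩ := Fintype.card_eq_one_iff.1 hA
  obtain ⟨b, hb⟩ := Fintype.card_eq_one_iff.1 hB
  have h1 : ∀ {C : Type} (m : E → C) (c c' : C), (∀ y, y = c) → ∀ x,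
      fiberSum m c' x = ∑ e, x e := by
    intro C m c c' hc x
    simp [fiberSum, hc (m _), hc c']
  ext x
  refine and_congr_right fun _ => ?_
  simp only [h1 l a _ ha, h1 r b _ hb]
  exact ⟨fun h => h.1 a, fun h => ⟨fun _ => h, fun _ => h⟩⟩

theorem stdSimplex_affIso {ι κ : Type} [Fintype ι] [Fintype κ] (ε : ι ≃ κ) :
    AffIso (stdSimplex ℝ ι) (stdSimplex ℝ κ) :=
  AffIso.of_linear (fun x => x ∘ ε.symm) (fun y => y ∘ ε) ⟨fun _ _ => rfl, fun _ _ => rfl⟩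
    ⟨fun _ _ => rfl, fun _ _ => rfl⟩
    (fun x hx => ⟨fun i => hx.1 _, (Equiv.sum_comp ε.symm x).trans hx.2⟩)
    (fun x hx => ⟨fun i => hx.1 _, (Equiv.sum_comp ε x).trans hx.2⟩)
    (fun x _ => by ext; simp) (fun x _ => by ext; simp)

theorem stdSimplex_one_affIso : AffIso (stdSimplex ℝ (Fin 1)) (cube 0) := by
  refine affIso_cube_zero ⟨fun _ => 1, by simp [stdSimplex]⟩ fun x hx y hy => ?_
  have h1 := hx.2
  have h2 := hy.2
  simp only [Fin.sum_univ_one] at h1 h2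
  ext i
  rw [Subsingleton.elim i 0, h1, h2]

theorem stdSimplex_two_affIso : AffIso (stdSimplex ℝ (Fin 2)) (cube 1) := by
  refine AffIso.of_linear_add (fun x _ => x 0) (fun y => ![y 0, -y 0]) ![0, 1]
    ⟨fun _ _ => rfl, fun _ _ => rfl⟩ ⟨fun x y => ?_, fun c x => ?_⟩ ?_ ?_ ?_ ?_
  · ext i
    fin_cases i
    · simp
    · simp [add_comm]
  · ext i
    fin_cases i <;> simp
  · rintro x ⟨hx, hs⟩
    rw [Fin.sum_univ_two] at hs
    exact mem_cube.2 fun _ => ⟨hx 0, by linarith [hx 1]⟩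
  · intro y hy
    have := mem_cube.1 hy 0
    refine ⟨fun i => ?_, by simp⟩
    fin_cases i <;> simp [this]
  · rintro x ⟨hx, hs⟩
    rw [Fin.sum_univ_two] at hs
    ext i
    fin_cases i
    · simp
    · simp
      linarith
  · intro y _
    ext i
    rw [Subsingleton.elim i 0]
    simp

end Bundle

-- The extremal graphs, with one double and one single edge at each vertex.

section Cycle

variable {A B E : Type}

/-- Each left vertex `a` has exactly three edges, two parallel ones `c₀ a`, `c₁ a`, and a third edge
`c₂ a` with a different right end. -/
structure IsDoubleSingle (l : E → A) (r : E → B) (c₀ c₁ c₂ : A → E) : Prop where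
  ne : ∀ a, c₀ a ≠ c₁ a
  parallel : ∀ a, r (c₀ a) = r (c₁ a)
  right_ne : ∀ a, r (c₂ a) ≠ r (c₀ a)
  left_eq_iff : ∀ a e, l e = a ↔ e = c₀ a ∨ e = c₁ a ∨ e = c₂ a

namespace IsDoubleSingle

variable {l : E → A} {r : E → B} {c₀ c₁ c₂ : A → E} {g₀ g₁ g₂ : B → E}

theorem left₀ (h : IsDoubleSingle l r c₀ c₁ c₂) (a : A) : l (c₀ a) = a :=
  (h.left_eq_iff a _).2 (Or.inl rfl)

theorem left₁ (h : IsDoubleSingle l r c₀ c₁ c₂) (a : A) : l (c₁ a) = a :=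
  (h.left_eq_iff a _).2 (Or.inr (Or.inl rfl))

theorem left₂ (h : IsDoubleSingle l r c₀ c₁ c₂) (a : A) : l (c₂ a) = a :=
  (h.left_eq_iff a _).2 (Or.inr (Or.inr rfl))

theorem ne₂₀ (h : IsDoubleSingle l r c₀ c₁ c₂) (a : A) : c₂ a ≠ c₀ a :=
  fun h' => h.right_ne a (by rw [h'])

theorem ne₂₁ (h : IsDoubleSingle l r c₀ c₁ c₂) (a : A) : c₂ a ≠ c₁ a :=
  fun h' => h.right_ne a (by rw [h', h.parallel])

theorem cases (h : IsDoubleSingle l r c₀ c₁ c₂) (e : E) :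
    ∃ a, e = c₀ a ∨ e = c₁ a ∨ e = c₂ a :=
  ⟨l e, (h.left_eq_iff _ e).1 rfl⟩

/-- If this edge belonged to the double pair at its right end, its partner would be a second edge
between the same two vertices. -/
theorem single_eq (hc : IsDoubleSingle l r c₀ c₁ c₂) (hg : IsDoubleSingle r l g₀ g₁ g₂) (a : A) :
    c₂ a = g₂ (r (c₂ a)) := by
  set b := r (c₂ a) with hb
  have aux : ∀ e, e ≠ c₂ a → l e = a → r e ≠ b := by
    intro e he hl
    rcases (hc.left_eq_iff a e).1 hl with rfl | rfl | rfl
    · exact (hc.right_ne a).symm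
    · exact fun h => hc.right_ne a (by rw [hc.parallel, h])
    · exact absurd rfl he
  rcases (hg.left_eq_iff b (c₂ a)).1 hb.symm with h | h | h
  · refine absurd (hg.left₁ b) (aux _ ?_ ?_)
    · rw [h]; exact (hg.ne b).symm
    · rw [← hg.parallel, ← h, hc.left₂]
  · refine absurd (hg.left₀ b) (aux _ ?_ ?_)
    · rw [h]; exact hg.ne b
    · rw [hg.parallel, ← h, hc.left₂]
  · exact h

theorem double_eq (hc : IsDoubleSingle l r c₀ c₁ c₂) (hg : IsDoubleSingle r l g₀ g₁ g₂) (a : A) :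
    (c₀ a = g₀ (r (c₀ a)) ∧ c₁ a = g₁ (r (c₀ a))) ∨
      (c₀ a = g₁ (r (c₀ a)) ∧ c₁ a = g₀ (r (c₀ a))) := by
  set b := r (c₀ a) with hb
  have h2 : g₂ b = c₂ (l (g₂ b)) := hg.single_eq hc b
  have h0 : c₀ a ≠ g₂ b := by
    intro h
    rw [← h, hc.left₀] at h2
    exact hc.ne₂₀ a h2.symm
  have h1 : c₁ a ≠ g₂ b := by
    intro h
    rw [← h, hc.left₁] at h2
    exact hc.ne₂₁ a h2.symm
  have hne := hc.ne a
  rcases (hg.left_eq_iff b (c₀ a)).1 hb.symm with h | h | h <;>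
  rcases (hg.left_eq_iff b (c₁ a)).1 (by rw [← hc.parallel]) with h' | h' | h'
  · exact absurd (h.trans h'.symm) hne
  · exact Or.inl ⟨h, h'⟩
  · exact absurd h' h1
  · exact Or.inr ⟨h, h'⟩
  · exact absurd (h.trans h'.symm) hne
  · exact absurd h' h1
  · exact absurd h h0
  · exact absurd h h0
  · exact absurd h h0

theorem fiberSum_eq [Fintype E] (h : IsDoubleSingle l r c₀ c₁ c₂) (a : A) (x : E → ℝ) :
    fiberSum l a x = x (c₀ a) + x (c₁ a) + x (c₂ a) := by
  classical
  have hf : (Finset.univ.filter fun e => l e = a) = {c₀ a, c₁ a, c₂ a} := by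
    ext e
    simp [h.left_eq_iff]
  rw [fiberSum_def, ← Finset.sum_filter, hf, Finset.sum_insert, Finset.sum_pair, add_assoc]
  · exact (h.ne₂₁ a).symm
  · simp [h.ne a, (h.ne₂₀ a).symm]

/-- Both ends of a double edge see the same double weight, so the single edges there have equal
weight. By connectedness all single edges share one weight `t`. At each left vertex one of the two
parallel edges has a free weight `u` with `0 ≤ u ≤ 1 - t`, and its twin has weight `1 - t - u`;
these inequalities describe the pyramid with height coordinate `t`. -/
theorem affIso_pyramid [Fintype A] [Fintype E] (hc : IsDoubleSingle l r c₀ c₁ c₂)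
    (hg : IsDoubleSingle r l g₀ g₁ g₂) (h : IsElementary l r) :
    AffIso (matchPoly l r) (pyramid (cube (Fintype.card A))) := by
  classical
  obtain ⟨o⟩ := h.nonempty
  set ε := Fintype.equivFin A
  have hconst : ∀ x ∈ matchPoly l r, ∀ a, x (c₂ a) = x (c₂ o) := by
    intro x hx
    have key : ∀ a, x (c₂ a) = x (g₂ (r (c₀ a))) := by
      intro a
      have h1 := hx.2.1 a
      have h2 := hx.2.2 (r (c₀ a))
      rw [hc.fiberSum_eq] at h1
      rw [hg.fiberSum_eq] at h2
      rcases hc.double_eq hg a with ⟨h3, h4⟩ | ⟨h3, h4⟩ <;> rw [← h3, ← h4] at h2 <;> linarith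
    obtain ⟨k, hk, -⟩ := h.eq_const (p := fun a => x (c₂ a)) (q := fun b => x (g₂ b)) (by
      intro e
      obtain ⟨a, rfl | rfl | rfl⟩ := hc.cases e
      · rw [hc.left₀, key]
      · rw [hc.left₁, key, hc.parallel]
      · rw [hc.left₂, ← hc.single_eq hg])
    intro a
    rw [hk a, hk o]
  -- The inverse map is affine: `g` is its linear part, and `c` contributes the constant 1 in the
  -- twin weight `1 - t - u`.
  set g : (Fin (Fintype.card A) → ℝ) × ℝ → E → ℝ := fun p e =>
    if e = c₀ (l e) then p.1 (ε (l e)) else if e = c₁ (l e) then -p.2 - p.1 (ε (l e)) else p.2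
    with hgdef
  set c : E → ℝ := fun e => if e = c₁ (l e) then 1 else 0 with hcdef
  have e0 : ∀ p a, g p (c₀ a) = p.1 (ε a) := fun p a => by simp [hgdef, hc.left₀]
  have e1 : ∀ p a, g p (c₁ a) = -p.2 - p.1 (ε a) := fun p a => by
    simp [hgdef, hc.left₁, (hc.ne a).symm]
  have e2 : ∀ p a, g p (c₂ a) = p.2 := fun p a => by
    simp [hgdef, hc.left₂, hc.ne₂₀, hc.ne₂₁]
  have k0 : ∀ a, c (c₀ a) = 0 := fun a => by simp [hcdef, hc.left₀, hc.ne a]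
  have k1 : ∀ a, c (c₁ a) = 1 := fun a => by simp [hcdef, hc.left₁]
  have k2 : ∀ a, c (c₂ a) = 0 := fun a => by simp [hcdef, hc.left₂, hc.ne₂₁]
  refine AffIso.of_linear_add (fun x => (fun i => x (c₀ (ε.symm i)), x (c₂ o))) g c
    ⟨fun _ _ => rfl, fun _ _ => rfl⟩ ⟨fun p q => ?_, fun k p => ?_⟩ ?_ ?_ ?_ ?_
  · ext e
    obtain ⟨a, rfl | rfl | rfl⟩ := hc.cases e
    · simp [e0]
    · simp [e1]; ring
    · simp [e2]
  · ext e
    obtain ⟨a, rfl | rfl | rfl⟩ := hc.cases e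
    · simp [e0]
    · simp [e1]; ring
    · simp [e2]
  · intro x hx
    refine mem_pyramid_cube.2 ⟨hx.1 _, le_one_of_mem_matchPoly hx _, fun i => ⟨hx.1 _, ?_⟩⟩
    have h1 := hx.2.1 (ε.symm i)
    rw [hc.fiberSum_eq, hconst x hx] at h1
    have := hx.1 (c₁ (ε.symm i))
    dsimp only
    linarith
  · intro p hp
    obtain ⟨h0, h1, hp⟩ := mem_pyramid_cube.1 hp
    refine ⟨fun e => ?_, fun a => ?_, fun b => ?_⟩
    · obtain ⟨a, rfl | rfl | rfl⟩ := hc.cases e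
      · simpa [e0, k0] using (hp _).1
      · simp only [Pi.add_apply, e1, k1]
        linarith [(hp (ε a)).2]
      · simpa [e2, k2] using h0
    · rw [hc.fiberSum_eq]
      simp only [Pi.add_apply, e0, e1, e2, k0, k1, k2]
      ring
    · rw [hg.fiberSum_eq, hg.single_eq hc b]
      rcases hg.double_eq hc b with ⟨h3, h4⟩ | ⟨h3, h4⟩ <;> rw [h3, h4] <;>
        simp only [Pi.add_apply, e0, e1, e2, k0, k1, k2] <;> ring
  · intro x hx
    ext e
    obtain ⟨a, rfl | rfl | rfl⟩ := hc.cases e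
    · simp [e0, k0]
    · have h1 := hx.2.1 a
      rw [hc.fiberSum_eq, hconst x hx] at h1
      simp [e1, k1]
      linarith
    · simp [e2, k2, hconst x hx a]
  · intro p _
    ext i
    · simp [e0, k0]
    · simp [e2, k2]

end IsDoubleSingle

end Cycle

-- Counting degrees and neighbors in the extremal case.

section Count

variable {A B E : Type} {l : E → A} {r : E → B}

/-- The number of vertices adjacent to `a`. -/
noncomputable def numNeighbors (l : E → A) (r : E → B) (a : A) : ℕ :=
  (r '' {e | l e = a}).ncard

theorem sum_numNeighbors [Fintype A] [Fintype E] (l : E → A) (r : E → B) : ∑ a, numNeighbors l r a = numPairs l r := by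
  classical
  have h1 : numPairs l r = (Finset.univ.image fun e => (l e, r e)).card := by
    rw [numPairs, ← ncard_coe_finset]
    simp
  rw [h1, Finset.card_eq_sum_card_fiberwise (f := Prod.fst) (t := Finset.univ) (by simp)]
  refine Finset.sum_congr rfl fun a _ => ?_
  have h2 : ((Finset.univ.image fun e => (l e, r e)).filter fun p => p.1 = a) =
      (Finset.univ.filter fun e => l e = a).image fun e => (a, r e) := by
    ext ⟨a', b'⟩
    simp only [Finset.mem_filter, Finset.mem_image, Finset.mem_univ, true_and, Prod.mk.injEq]
    constructor
    · rintro ⟨⟨e, h1, h2⟩, h3⟩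
      exact ⟨e, h1.trans h3, h3.symm, h2⟩
    · rintro ⟨e, h1, h2, h3⟩
      exact ⟨⟨e, h1.trans h2, h3⟩, h2.symm⟩
  have h3 : ((Finset.univ.filter fun e => l e = a).image fun e => (a, r e)) =
      ((Finset.univ.filter fun e => l e = a).image r).image (Prod.mk a) := by
    rw [Finset.image_image]
    rfl
  rw [h2, h3, Finset.card_image_of_injective _ (Prod.mk_right_injective a), numNeighbors,
    ← ncard_coe_finset]
  simp

theorem numPairs_comm (l : E → A) (r : E → B) : numPairs l r = numPairs r l := by
  rw [numPairs, numPairs, ← ncard_image_of_injective _ Prod.swap_injective, ← range_comp]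
  rfl

theorem IsElementary.two_le_numNeighbors [Fintype A] [Fintype E] (h : IsElementary l r) (hA : 2 ≤ Fintype.card A) (a : A) :
    2 ≤ numNeighbors l r a := by
  obtain ⟨e, e', he, he', hne⟩ := h.exists_two_neighbors hA a
  rw [← ncard_pair hne]
  refine ncard_le_ncard ?_ (toFinite _)
  rintro _ (rfl | rfl)
  exacts [⟨e, he, rfl⟩, ⟨e', he', rfl⟩]

theorem IsElementary.two_mul_card_le_numPairs [Fintype A] [Fintype E] (h : IsElementary l r) (hA : 2 ≤ Fintype.card A) :
    2 * Fintype.card A ≤ numPairs l r := by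
  rw [← sum_numNeighbors, mul_comm, ← smul_eq_mul]
  exact Finset.card_nsmul_le_sum _ _ _ fun a _ => h.two_le_numNeighbors hA a

theorem exists_double_single [Fintype E] {a : A} (hd : degree l a = 3) (hn : numNeighbors l r a = 2) :
    ∃ e₀ e₁ e₂, e₀ ≠ e₁ ∧ r e₀ = r e₁ ∧ r e₂ ≠ r e₀ ∧ ∀ e, l e = a ↔ e = e₀ ∨ e = e₁ ∨ e = e₂ := by
  classical
  obtain ⟨x, y, z, hxy, hxz, hyz, hf⟩ := Finset.card_eq_three.1 hd
  have hmem : ∀ e, l e = a ↔ e = x ∨ e = y ∨ e = z := by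
    intro e
    have : e ∈ Finset.univ.filter (fun e => l e = a) ↔ e ∈ ({x, y, z} : Finset E) := by rw [← hf]
    simpa using this
  have himg : r '' {e | l e = a} = {r x, r y, r z} := by
    have : {e | l e = a} = {x, y, z} := by
      ext e
      simp [hmem]
    rw [this, image_insert_eq, image_pair]
  rw [numNeighbors, himg] at hn
  by_cases h1 : r x = r y
  · refine ⟨x, y, z, hxy, h1, fun h => ?_, hmem⟩
    simp [h, ← h1] at hn
  · by_cases h2 : r x = r z
    · exact ⟨x, z, y, hxz, h2, fun h => h1 h.symm, fun e => by rw [hmem]; tauto⟩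
    · by_cases h3 : r y = r z
      · exact ⟨y, z, x, hyz, h3, h1, fun e => by rw [hmem]; tauto⟩
      · have := ncard_eq_three.2 ⟨_, _, _, h1, h2, h3, rfl⟩
        omega

/-- The upper bounds on the sums force equality at every vertex: three edges, two neighbors. -/
theorem exists_isDoubleSingle [Fintype A] [Fintype E] (hd : ∀ a, 3 ≤ degree l a) (hn : ∀ a, 2 ≤ numNeighbors l r a)
    (hE : Fintype.card E ≤ 3 * Fintype.card A) (hp : numPairs l r ≤ 2 * Fintype.card A) :
    ∃ c₀ c₁ c₂, IsDoubleSingle l r c₀ c₁ c₂ := by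
  have key : ∀ (f : A → ℕ) k, (∀ a, k ≤ f a) → ∑ a, f a ≤ k * Fintype.card A → ∀ a, f a = k := by
    intro f k hk hs a
    have h1 : ∑ a : A, k = ∑ a, f a :=
      le_antisymm (Finset.sum_le_sum fun a _ => hk a) (by simpa [mul_comm] using hs)
    exact ((Finset.sum_eq_sum_iff_of_le fun a _ => hk a).1 h1 a (Finset.mem_univ a)).symm
  have h1 := key _ 3 hd (by rwa [sum_degree])
  have h2 := key _ 2 hn (by rwa [sum_numNeighbors])
  choose c₀ c₁ c₂ h using fun a => exists_double_single (h1 a) (h2 a)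
  exact ⟨c₀, c₁, c₂, fun a => (h a).1, fun a => (h a).2.1, fun a => (h a).2.2.1,
    fun a => (h a).2.2.2⟩

end Count

-- Classification by the defect `2d - m`.

section Classification

/-- The classification of a `d`-dimensional matching polytope `P` of a simple graph with `n` vertices
on each side: it can be realized by a small graph, or it is one of the listed polytopes. -/
def Classified {V : Type*} [AddCommGroup V] [Module ℝ V] (P : Set V) (d n : ℕ) : Prop :=
  ∃ m, Realizable m P ∧ (m + 3 ≤ 2 * d ∨
    (m ≤ 2 * d ∧ 2 * d ≤ n ∧ AffIso P (cube d)) ∨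
    (m + 1 ≤ 2 * d ∧ 2 * d ≤ n + 1 ∧ ∃ a, a + 2 = d ∧ AffIso P (cube a ×ˢ triangle)) ∨
    (m + 2 ≤ 2 * d ∧
      ((∃ a b, 2 ≤ b ∧ a + (b + 1) = d ∧ AffIso P (cube a ×ˢ pyramid (cube b))) ∨
      ∃ a, a + 4 = d ∧ AffIso P (triangle ×ˢ triangle ×ˢ cube a))))

variable {V W : Type*} [AddCommGroup V] [Module ℝ V] [AddCommGroup W] [Module ℝ W]
  {P : Set V} {Q : Set W} {d d' n n' : ℕ}

theorem Classified.of_affIso (h : Classified P d n) (hPQ : AffIso P Q) : Classified Q d n := by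
  obtain ⟨m, hm, h⟩ := h
  refine ⟨m, hm.of_affIso hPQ, ?_⟩
  rcases h with h | ⟨h1, h2, h3⟩ | ⟨h1, h2, a, h3, h4⟩ | ⟨h1, ⟨a, b, h2, h3, h4⟩ | ⟨a, h2, h3⟩⟩
  · exact Or.inl h
  · exact Or.inr (Or.inl ⟨h1, h2, hPQ.symm.trans h3⟩)
  · exact Or.inr (Or.inr (Or.inl ⟨h1, h2, a, h3, hPQ.symm.trans h4⟩))
  · exact Or.inr (Or.inr (Or.inr ⟨h1, Or.inl ⟨a, b, h2, h3, hPQ.symm.trans h4⟩⟩))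
  · exact Or.inr (Or.inr (Or.inr ⟨h1, Or.inr ⟨a, h2, hPQ.symm.trans h3⟩⟩))

theorem AffIso.cube_prod {c a : ℕ} {U : Type*} [AddCommGroup U] [Module ℝ U] {R : Set U}
    (hP : AffIso P (cube c)) (hQ : AffIso Q (cube a ×ˢ R)) :
    AffIso (P ×ˢ Q) (cube (c + a) ×ˢ R) :=
  (hP.prod hQ).trans ((AffIso.prod_assoc _ _ _).symm.trans
    ((cube_prod_cube c a).prod (AffIso.refl R)))

theorem classified_cube_prod (hP : AffIso P (cube d)) (hdn : 2 * d ≤ n) {m : ℕ}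
    (hm : Realizable m P) (hmd : m ≤ 2 * d) (hQ : Classified Q d' n') :
    Classified (P ×ˢ Q) (d + d') (n + n') := by
  obtain ⟨m', hm', h⟩ := hQ
  refine ⟨m + m', hm.prod hm', ?_⟩
  rcases h with h | ⟨h1, h2, h3⟩ | ⟨h1, h2, a, h3, h4⟩ | ⟨h1, ⟨a, b, h2, h3, h4⟩ | ⟨a, h2, h3⟩⟩
  · left; omega
  · exact Or.inr (Or.inl ⟨by omega, by omega, (hP.prod h3).trans (cube_prod_cube _ _)⟩)
  · exact Or.inr (Or.inr (Or.inl ⟨by omega, by omega, d + a, by omega, hP.cube_prod h4⟩))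
  · exact Or.inr (Or.inr (Or.inr ⟨by omega,
      Or.inl ⟨d + a, b, h2, by omega, hP.cube_prod h4⟩⟩))
  · have h4 : AffIso (triangle ×ˢ triangle ×ˢ cube a) (cube a ×ˢ triangle ×ˢ triangle) :=
      (AffIso.prod_assoc _ _ _).symm.trans (AffIso.prod_comm _ _)
    have h5 : AffIso (cube (d + a) ×ˢ triangle ×ˢ triangle)
        (triangle ×ˢ triangle ×ˢ cube (d + a)) :=
      (AffIso.prod_comm _ _).trans (AffIso.prod_assoc _ _ _)
    exact Or.inr (Or.inr (Or.inr ⟨by omega,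
      Or.inr ⟨d + a, by omega, (hP.cube_prod (h3.trans h4)).trans h5⟩⟩))

/-- Defects add. A cube factor has defect 0 and is absorbed, two triangle factors reach defect 2,
and every other combination of two factors with positive defect has defect at least 3. -/
theorem Classified.prod (hP : Classified P d n) (hQ : Classified Q d' n') :
    Classified (P ×ˢ Q) (d + d') (n + n') := by
  have hP' := hP
  have hQ' := hQ
  obtain ⟨m, hm, h⟩ := hP
  obtain ⟨m', hm', h'⟩ := hQ
  rcases h with h | ⟨h1, h2, h3⟩ | ⟨h1, h2, a, h3, h4⟩ | ⟨h1, -⟩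
  · exact ⟨m + m', hm.prod hm', Or.inl (by omega)⟩
  · exact classified_cube_prod h3 h2 hm h1 hQ'
  · rcases h' with h' | ⟨h1', h2', h3'⟩ | ⟨h1', h2', a', h3', h4'⟩ | ⟨h1', -⟩
    · exact ⟨m + m', hm.prod hm', Or.inl (by omega)⟩
    · rw [add_comm d, add_comm n]
      exact (classified_cube_prod h3' h2' hm' h1' hP').of_affIso (AffIso.prod_comm _ _)
    · have h5 := (h4.trans (AffIso.prod_comm _ _)).prod (h4'.trans (AffIso.prod_comm _ _))
      have h6 : AffIso ((triangle ×ˢ cube a) ×ˢ triangle ×ˢ cube a')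
          (triangle ×ˢ triangle ×ˢ cube (a + a')) := by
        refine (AffIso.prod_assoc _ _ _).trans ((AffIso.refl _).prod ?_)
        refine (AffIso.prod_assoc _ _ _).symm.trans ?_
        refine ((AffIso.prod_comm _ _).prod (AffIso.refl _)).trans ?_
        exact (AffIso.prod_assoc _ _ _).trans ((AffIso.refl _).prod (cube_prod_cube _ _))
      exact ⟨m + m', hm.prod hm', Or.inr (Or.inr (Or.inr ⟨by omega,
        Or.inr ⟨a + a', by omega, h5.trans h6⟩⟩))⟩
    · exact ⟨m + m', hm.prod hm', Or.inl (by omega)⟩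
  · rcases h' with h' | ⟨h1', h2', h3'⟩ | ⟨h1', h2', a', h3', h4'⟩ | ⟨h1', -⟩
    · exact ⟨m + m', hm.prod hm', Or.inl (by omega)⟩
    · rw [add_comm d, add_comm n]
      exact (classified_cube_prod h3' h2' hm' h1' hP').of_affIso (AffIso.prod_comm _ _)
    · exact ⟨m + m', hm.prod hm', Or.inl (by omega)⟩
    · exact ⟨m + m', hm.prod hm', Or.inl (by omega)⟩

theorem IsElementary.classified_of_card_eq_one {A B E : Type} [Fintype A] [Fintype B] [Fintype E]
    {l : E → A} {r : E → B} (h : IsElementary l r) (hA : Fintype.card A = 1)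
    (h1 : d = 1 → 2 ≤ n) (h2 : d = 2 → 3 ≤ n)
    (hd : Module.finrank ℝ (vectorSpan ℝ (matchPoly l r)) = d) :
    Classified (matchPoly l r) d n := by
  have hB : Fintype.card B = 1 := by
    rw [← hA, card_eq_of_matchPoly_nonempty h.matchPoly_nonempty]
  have hcard := h.finrank_add_card
  rw [hd, hA, hB] at hcard
  have hreal : Realizable (d + 1) (matchPoly l r) := by
    have h1 : 1 ≤ numPairs l r := by
      obtain ⟨x, hx⟩ := h.matchPoly_nonempty
      obtain ⟨a⟩ := h.nonempty
      obtain ⟨e, -⟩ := exists_edge_of_mem_matchPoly hx a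
      exact (ncard_pos (finite_range _)).2 ⟨_, e, rfl⟩
    have := realizable_matchPoly l r (k := d) (by omega) (by omega)
    rwa [hA, add_comm] at this
  have hs := matchPoly_eq_stdSimplex l r hA hB
  have hiso : AffIso (matchPoly l r) (stdSimplex ℝ (Fin (d + 1))) := by
    rw [hs]
    exact stdSimplex_affIso (Fintype.equivFinOfCardEq (by omega))
  match d with
  | 0 =>
    have hpt := hiso.trans stdSimplex_one_affIso
    -- A point is realized by the empty graph, so that it too has defect 0.
    refine ⟨0, ?_, Or.inr (Or.inl ⟨le_rfl, by omega, hpt⟩)⟩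
    refine ⟨Empty, Empty, Empty, inferInstance, inferInstance, inferInstance, id, id, by simp,
      rfl, fun e => e.elim, hpt.trans (affIso_cube_zero ⟨0, ?_⟩ fun x _ y _ => ?_).symm⟩
    · exact ⟨fun e => e.elim, fun e => e.elim, fun e => e.elim⟩
    · ext e
      exact e.elim
  | 1 =>
    exact ⟨2, hreal, Or.inr (Or.inl ⟨by omega, by simpa using h1,
      hiso.trans stdSimplex_two_affIso⟩)⟩
  | 2 =>
    exact ⟨3, hreal, Or.inr (Or.inr (Or.inl ⟨by omega, by simpa using h2, 0, rfl,
      hiso.trans (affIso_cube_zero_prod _)⟩))⟩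
  | 3 => exact ⟨3, realizable_tetrahedron l r hA hB (by omega), Or.inl (by omega)⟩
  | k + 4 => exact ⟨k + 5, hreal, Or.inl (by omega)⟩

/-- With `k` vertices per side, `m = k + |E| - p` and `d = |E| - 2k + 1`. Since `|E| ≥ 3k` and `p ≥
2k`, the defect is at least 2, and at least 3 unless both bounds are attained. -/
theorem IsElementary.classified_of_three_le_degree {A B E : Type} [Fintype A] [Fintype B]
    [Fintype E] {l : E → A} {r : E → B} (h : IsElementary l r) (hA : 2 ≤ Fintype.card A)
    (hl : ∀ a, 3 ≤ degree l a) (hr : ∀ b, 3 ≤ degree r b)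
    (hd : Module.finrank ℝ (vectorSpan ℝ (matchPoly l r)) = d) :
    Classified (matchPoly l r) d n := by
  have hAB := card_eq_of_matchPoly_nonempty h.matchPoly_nonempty
  have hcard := h.finrank_add_card
  rw [hd] at hcard
  have hE : Fintype.card A * 3 ≤ Fintype.card E := by
    rw [← sum_degree l, ← smul_eq_mul]
    exact Finset.card_nsmul_le_sum _ _ _ fun a _ => hl a
  have hp := h.two_mul_card_le_numPairs hA
  have hpE : numPairs l r ≤ Fintype.card E := by
    rw [numPairs, ← image_univ, ← Nat.card_eq_fintype_card, ← ncard_univ]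
    exact ncard_image_le finite_univ
  have hreal := realizable_matchPoly l r hAB.symm (k := Fintype.card E - numPairs l r) (by omega)
  refine ⟨_, hreal, ?_⟩
  by_cases hc : Fintype.card E ≤ 3 * Fintype.card A ∧ numPairs l r ≤ 2 * Fintype.card A
  · obtain ⟨c₀, c₁, c₂, hc1⟩ := exists_isDoubleSingle hl (h.two_le_numNeighbors hA) hc.1 hc.2
    obtain ⟨g₀, g₁, g₂, hg1⟩ := exists_isDoubleSingle hr
      (h.symm.two_le_numNeighbors (hAB ▸ hA)) (hAB ▸ hc.1)
      (by rw [numPairs_comm]; exact hAB ▸ hc.2)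
    exact Or.inr (Or.inr (Or.inr ⟨by omega, Or.inl ⟨0, Fintype.card A, hA, by omega,
      (hc1.affIso_pyramid hg1 h).trans (affIso_cube_zero_prod _)⟩⟩))
  · left
    omega

theorem IsElementary.classified {A B E : Type} [Fintype A] [Fintype B] [Fintype E]
    {l : E → A} {r : E → B} (h : IsElementary l r) (hinj : Function.Injective fun e => (l e, r e)) :
    Classified (matchPoly l r) (Module.finrank ℝ (vectorSpan ℝ (matchPoly l r)))
      (Fintype.card A) := by
  have hAB := card_eq_of_matchPoly_nonempty h.matchPoly_nonempty
  have hcard := h.finrank_add_card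
  have hE : Fintype.card E ≤ Fintype.card A * Fintype.card A := by
    have := Fintype.card_le_of_injective _ hinj
    rwa [Fintype.card_prod, ← hAB] at this
  set d := Module.finrank ℝ (vectorSpan ℝ (matchPoly l r)) with hd
  have hA1 : 1 ≤ Fintype.card A := by
    have := h.nonempty
    exact Fintype.card_pos
  -- These lower bounds use `|E| ≤ |A|²`, so they must be obtained before the reduction destroys
  -- simplicity.
  have h1 : d = 1 → 2 ≤ Fintype.card A := by
    intro hd1
    by_contra hcon
    obtain hA : Fintype.card A = 1 := by omega
    simp only [hA] at hE
    omega
  have h2 : d = 2 → 3 ≤ Fintype.card A := by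
    intro hd1
    by_contra hcon
    obtain hA | hA : Fintype.card A = 1 ∨ Fintype.card A = 2 := by omega
    all_goals
      simp only [hA] at hE
      omega
  obtain ⟨A', B', E', _, _, _, l', r', h', hiso, hred⟩ := h.exists_reduced
  have hd' : Module.finrank ℝ (vectorSpan ℝ (matchPoly l' r')) = d :=
    hiso.finrank_vectorSpan_eq.symm
  refine Classified.of_affIso ?_ hiso.symm
  rcases hred with hA' | ⟨hA', hl', hr'⟩
  · exact h'.classified_of_card_eq_one hA' h1 h2 hd'
  · exact h'.classified_of_three_le_degree hA' hl' hr' hd'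

/-- Induction over separations of the graph: `d` and the number of left vertices are additive over
its pieces, as `Classified.prod` needs. -/
theorem classified_matchPoly {A B E : Type} [Fintype A] [Fintype B] [Fintype E]
    {l : E → A} {r : E → B} (hpos : ∃ x ∈ matchPoly l r, ∀ e, 0 < x e)
    (hinj : Function.Injective fun e => (l e, r e)) :
    Classified (matchPoly l r) (Module.finrank ℝ (vectorSpan ℝ (matchPoly l r)))
      (Fintype.card A) := by
  classical
  induction hn : Fintype.card A + Fintype.card B using Nat.strong_induction_on
    generalizing A B E with
  | _ k ih =>
    by_cases hcon : ∀ (S : Set A) (T : Set B), (∀ e, l e ∈ S ↔ r e ∈ T) →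
        (S = ∅ ∧ T = ∅) ∨ (S = univ ∧ T = univ)
    · rcases isEmpty_or_nonempty A with hA | hA
      · have : IsEmpty E := Function.isEmpty l
        obtain ⟨x, hx, -⟩ := hpos
        have hsub : (matchPoly l r).Subsingleton := fun x _ y _ => Subsingleton.elim x y
        have hd : Module.finrank ℝ (vectorSpan ℝ (matchPoly l r)) = 0 := by
          rw [vectorSpan_of_subsingleton ℝ hsub, finrank_bot]
        rw [hd]
        exact ⟨0, ⟨A, B, E, inferInstance, inferInstance, inferInstance, l, r, by simp,
          (card_eq_of_matchPoly_nonempty ⟨x, hx⟩).symm, hinj, AffIso.refl _⟩,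
          Or.inr (Or.inl ⟨by simp, by simp, affIso_cube_zero ⟨x, hx⟩ hsub⟩)⟩
      · exact IsElementary.classified ⟨hA, hcon, hpos⟩ hinj
    · push Not at hcon
      obtain ⟨S, T, hST, hne, hnu⟩ := hcon
      have hST' : ∀ e, l e ∈ Sᶜ ↔ r e ∈ Tᶜ := fun e => not_congr (hST e)
      obtain ⟨x, hx, hx0⟩ := hpos
      have hx1 := comp_mem_matchPoly_restrictEnd hST hx
      have hx2 := comp_mem_matchPoly_restrictEnd hST' hx
      have hAS : Fintype.card S + Fintype.card (Sᶜ : Set A) = Fintype.card A := by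
        rw [← Fintype.card_sum]
        exact Fintype.card_congr (Equiv.Set.sumCompl S)
      have hBT : Fintype.card T + Fintype.card (Tᶜ : Set B) = Fintype.card B := by
        rw [← Fintype.card_sum]
        exact Fintype.card_congr (Equiv.Set.sumCompl T)
      have hpos1 : 0 < Fintype.card S + Fintype.card T := by
        by_contra h0
        simp only [not_lt, nonpos_iff_eq_zero, Nat.add_eq_zero_iff, Fintype.card_eq_zero_iff,
          isEmpty_coe_sort] at h0
        exact (hne h0.1).ne_empty h0.2
      have hpos2 : 0 < Fintype.card (Sᶜ : Set A) + Fintype.card (Tᶜ : Set B) := by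
        by_contra h0
        simp only [not_lt, nonpos_iff_eq_zero, Nat.add_eq_zero_iff, Fintype.card_eq_zero_iff,
          isEmpty_coe_sort, compl_empty_iff] at h0
        exact hnu h0.1 h0.2
      have hiso := matchPoly_affIso_prod hST hST'
      have hi1 : ∀ (S : Set A) (T : Set B) (h : ∀ e, l e ∈ S ↔ r e ∈ T), Function.Injective
          fun e => (restrictEnd l l S S (fun _ h => h) e,
            restrictEnd l r S T (fun e => (h e).1) e) := by
        intro S T h e e' he
        apply Subtype.ext
        apply hinj
        simpa [restrictEnd] using he
      have c1 := ih _ (by omega) ⟨_, hx1, fun e => hx0 _⟩ (hi1 S T hST) rfl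
      have c2 := ih _ (by omega) ⟨_, hx2, fun e => hx0 _⟩ (hi1 Sᶜ Tᶜ hST') rfl
      have c3 := (c1.prod c2).of_affIso hiso.symm
      rwa [hAS, ← finrank_vectorSpan_prod ⟨_, hx1⟩ ⟨_, hx2⟩, ← hiso.finrank_vectorSpan_eq] at c3

end Classification

-- From the classification to the Birkhoff dimension.

theorem finrank_vectorSpan_eq_of_isCombType {L : Type*} [PartialOrder L] {m n : ℕ}
    {F : Set (Matrix (Fin m) (Fin m) ℝ)} {G : Set (Matrix (Fin n) (Fin n) ℝ)}
    (hF : IsExposed ℝ (birkhoffPolytope m) F) (hG : IsExposed ℝ (birkhoffPolytope n) G)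
    (hFne : F.Nonempty) (hGne : G.Nonempty) (hLF : IsCombType L F) (hLG : IsCombType L G) :
    Module.finrank ℝ (vectorSpan ℝ F) = Module.finrank ℝ (vectorSpan ℝ G) := by
  obtain ⟨E, _, l, r, -, hiso, x, hx, -⟩ := exists_matchPoly_of_isExposed hF hFne
  obtain ⟨E', _, l', r', -, hiso', x', hx', -⟩ := exists_matchPoly_of_isExposed hG hGne
  rw [hiso.finrank_vectorSpan_eq, hiso'.finrank_vectorSpan_eq]
  obtain ⟨e⟩ := hiso.isCombType hLF
  obtain ⟨e'⟩ := hiso'.isCombType hLG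
  have h := matchPoly_eq_nonnegSlice hx
  have h' := matchPoly_eq_nonnegSlice hx'
  rw [h] at hx e ⊢
  rw [h'] at hx' e' ⊢
  exact finrank_vectorSpan_eq_of_orderIso ⟨x, hx⟩ ⟨x', hx'⟩ (e.symm.trans e')

/-- The empty set has one face, while a non-empty set has at least two: the empty face and itself.
-/
theorem IsCombType.nonempty {L : Type*} [PartialOrder L] {V W : Type*} [AddCommGroup V]
    [Module ℝ V] [TopologicalSpace V] [AddCommGroup W] [Module ℝ W] [TopologicalSpace W]
    {P : Set V} {Q : Set W} (hP : IsCombType L P) (hQ : IsCombType L Q) (hne : P.Nonempty) :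
    Q.Nonempty := by
  rw [nonempty_iff_ne_empty]
  rintro rfl
  obtain ⟨e⟩ := hP
  obtain ⟨e'⟩ := hQ
  have hsub : ∀ X Y : FaceLattice (∅ : Set W), X = Y := fun X Y =>
    Subtype.ext ((subset_empty_iff.1 X.2.subset).trans (subset_empty_iff.1 Y.2.subset).symm)
  have h1 := (e.symm.trans e').injective (hsub _ _ :
    (e.symm.trans e') ⟨∅, fun h => absurd h (by simp)⟩ = (e.symm.trans e') ⊤)
  exact hne.ne_empty (congrArg Subtype.val h1).symm

theorem bdim_le_of_realizable {L : Type*} [PartialOrder L] {V : Type*} [AddCommGroup V]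
    [Module ℝ V] [TopologicalSpace V] [IsTopologicalAddGroup V] [ContinuousSMul ℝ V] [T2Space V]
    [FiniteDimensional ℝ V] {P : Set V} (hL : IsCombType L P) {m : ℕ} (h : Realizable m P)
    (hd : 0 < Module.finrank ℝ (vectorSpan ℝ P)) : bdim L ≤ m := by
  obtain ⟨k, hk, F, hF, hiso⟩ := h.exists_isExposed
  refine le_trans (Nat.sInf_le ⟨?_, F, hF, hiso.isCombType hL⟩) hk
  by_contra hk0
  obtain rfl : k = 0 := by omega
  rw [hiso.finrank_vectorSpan_eq,
    vectorSpan_of_subsingleton ℝ (fun x _ y _ => Subsingleton.elim x y), finrank_bot] at hd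
  exact hd.false

theorem mainTheorem1 (L : Type*) [PartialOrder L] (d : ℕ) (hL : IsBirkhoffType L d)
    (hdim : 2 * (d : ℤ) - 2 ≤ bdim L) :
    ((bdim L : ℤ) = 2 * d → IsCombType L (cube d)) ∧
    ((bdim L : ℤ) = 2 * d - 1 →
      ∃ a : ℕ, a + 2 = d ∧ IsCombType L (cube a ×ˢ triangle)) ∧
    ((bdim L : ℤ) = 2 * d - 2 →
      (∃ b : ℕ, 2 ≤ b ∧ b + 1 = d ∧ IsCombType L (pyramid (cube b))) ∨
      (∃ a b : ℕ, 1 ≤ a ∧ 2 ≤ b ∧ a + (b + 1) = d ∧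
        IsCombType L (cube a ×ˢ pyramid (cube b))) ∨
      (∃ a : ℕ, a + 4 = d ∧ IsCombType L (triangle ×ˢ triangle ×ˢ cube a))) := by
  obtain ⟨n₀, hn₀, F₀, hF₀, hF₀ne, hF₀d, hLF₀⟩ := hL
  have hmem : bdim L ∈ {n : ℕ | 1 ≤ n ∧ ∃ F : Set (Matrix (Fin n) (Fin n) ℝ),
      IsExposed ℝ (birkhoffPolytope n) F ∧ IsCombType L F} :=
    Nat.sInf_mem ⟨n₀, hn₀, F₀, hF₀, hLF₀⟩
  obtain ⟨hn1, F, hF, hLF⟩ := hmem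
  have hFne : F.Nonempty := hLF₀.nonempty hLF hF₀ne
  have hFd : Module.finrank ℝ (vectorSpan ℝ F) = d := by
    rw [← hF₀d]
    exact finrank_vectorSpan_eq_of_isCombType hF hF₀ hFne hF₀ne hLF hLF₀
  obtain ⟨E, _, l, r, hinj, hiso, hpos⟩ := exists_matchPoly_of_isExposed hF hFne
  have hLP := hiso.isCombType hLF
  have hPd : Module.finrank ℝ (vectorSpan ℝ (matchPoly l r)) = d := by
    rw [← hiso.finrank_vectorSpan_eq, hFd]
  have hc := classified_matchPoly hpos hinj
  rw [hPd, Fintype.card_fin] at hc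
  obtain ⟨m, hm, hc⟩ := hc
  have hle : 0 < d → bdim L ≤ m := fun h => bdim_le_of_realizable hLP hm (by omega)
  rcases hc with h | ⟨h1, h2, h3⟩ | ⟨h1, h2, a, h3, h4⟩ | ⟨h1, hlist⟩
  · have := hle (by omega)
    omega
  -- For a cube, the bound `2 * d ≤ bdim L` in `h2` excludes the two smaller values.
  · exact ⟨fun _ => h3.isCombType hLP, fun h => by omega, fun h => by omega⟩
  · have := hle (by omega)
    exact ⟨fun h => by omega, fun _ => ⟨a, h3, h4.isCombType hLP⟩, fun h => by omega⟩
  · have hd0 : 0 < d := by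
      rcases hlist with ⟨a, b, hb, hab, -⟩ | ⟨a, ha, -⟩ <;> omega
    have := hle hd0
    refine ⟨fun h => by omega, fun h => by omega, fun _ => ?_⟩
    rcases hlist with ⟨a, b, hb, hab, h⟩ | ⟨a, ha, h⟩
    · rcases Nat.eq_zero_or_pos a with rfl | ha
      · exact Or.inl ⟨b, hb, by omega, (h.trans (affIso_cube_zero_prod _).symm).isCombType hLP⟩
      · exact Or.inr (Or.inl ⟨a, b, ha, hb, hab, h.isCombType hLP⟩)
    · exact Or.inr (Or.inr ⟨a, ha, h.isCombType hLP⟩)
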